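/- Let $n\ge 0$, let $u^0\in\mathbb{C}^n$ and let $\mathbb{D}=\{u\in\mathbb{C}^n: |u_j-u_j^0|<r_j,\ j=1,\dots,n\}$ ($r_j>0$) be a polydisc. Let $A(u)$ be an $n\times n$ matrix holomorphic on $\mathbb{D}$, let $\omega_1(z,u),\dots,\omega_n(z,u)$ be $n\times n$ matrices holomorphic on $\mathbb{C}\times\mathbb{D}$, and put $\Lambda=\operatorname{diag}(u_1,\dots,u_n)$, $\omega_0(z,u)=\Lambda+A(u)/z$. Suppose that the Pfaffian system $$dY=\omega Y,\qquad \omega=\omega_0(z,u)\,dz+\sum_{j=1}^n\omega_j(z,u)\,du_j,$$ is completely integrable on $(\mathbb{C}\setminus\{0\})\times\mathbb{D}$, that is, $d\omega=\omega\wedge\omega$: with $(x_0,x_1,\dots,x_n)=(z,u_1,\dots,u_n)$, $$\frac{\partial\omega_\beta}{\partial x_\alpha}+\omega_\beta\omega_\alpha=\frac{\partial\omega_\alpha}{\partial x_\beta}+\omega_\alpha\omega_\beta\qquad(\alpha\ne\beta).$$ Let $\mathcal{R}$ be the universal covering of $\mathbb{C}\setminus\{0\}$. Then the system has a fundamental matrix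 solution (a solution with invertible values, holomorphic on $\mathcal{R}\times\mathbb{D}$) in Levelt form $$Y^{(0)}(z,u)=\widehat Y(z,u)\,z^Dz^L,\qquad \widehat Y(z,u)=G(u)\Big(I+\sum_{j\ge1}\Psi_j(u)z^j\Big),$$ where the exponents $D$, $L$ are matrices independent of $(z,u)$, the series converges for all $(z,u)\in\mathbb{C}\times\mathbb{D}$, its coefficients $\Psi_j$ are holomorphic on $\mathbb{D}$, and $\widehat Y$ is holomorphic on $\mathbb{C}\times\mathbb{D}$. Here Levelt form means, for all $u\in\mathbb{D}$: 1. $L=L_1\oplus\cdots\oplus L_\ell$ is block diagonal, each $L_q$ is upper triangular with only one eigenvalue $\sigma_q$, $0\le\operatorname{Re}\sigma_q<1$, and $\sigma_p\ne\sigma_q$ for $p\neq q$. 2. $D=D_1\oplus\cdots\oplus D_\ell$, with blocks of the same sizes, $D_q=\operatorname{diag}(d_{q,1},d_{q,2},\dots)$ with integers $d_{q,1}\ge d_{q,2}\ge\cdots$. 3. The eigenvalues of $A(u)$, counted with multiplicity, are the numbers $d_{q,s}+\sigma_q$. 4. $G$ is holomorphic with invertible values on $\mathbb{D}$, $\partial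 G/\partial u_j=\omega_j(0,u)G$ for $j=1,\dots,n$, and $G(u)^{-1}A(u)G(u)=J$ is a Jordan matrix independent of $u$. 5. $\widehat Y(z,u)\,(D+z^DLz^{-D})\,\widehat Y(z,u)^{-1}$ is holomorphic at $z=0$, and $$\lim_{z\to0}\widehat Y(z,u)\,(D+z^DLz^{-D})\,\widehat Y(z,u)^{-1}=\lim_{z\to0}G(u)\,(D+z^DLz^{-D})\,G(u)^{-1}=A(u),\qquad D+\lim_{z\to0}z^DLz^{-D}=J.$$ -/

import Mathlib

open scoped Topology

/-- The open polydisc with centre `u0` and polyradius `r`. -/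
def polydisc {n : ℕ} (u0 : Fin n → ℂ) (r : Fin n → ℝ) : Set (Fin n → ℂ) :=
  {u | ∀ j, ‖u j - u0 j‖ < r j}

/-- A matrix-valued function is holomorphic on `s` (used for open `s`):
every entry is complex differentiable, jointly in all variables. -/
def HolomorphicMatrixOn {E : Type*} [NormedAddCommGroup E] [NormedSpace ℂ E] {n : ℕ}
    (f : E → Matrix (Fin n) (Fin n) ℂ) (s : Set E) : Prop :=
  ∀ a b, DifferentiableOn ℂ (fun x => f x a b) s

/-- Entrywise derivative of a matrix-valued function of one complex variable. -/
noncomputable def matrixDeriv {n : ℕ} (f : ℂ → Matrix (Fin n) (Fin n) ℂ) (t : ℂ) :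
    Matrix (Fin n) (Fin n) ℂ :=
  Matrix.of fun a b => deriv (fun s => f s a b) t

/-- The partial derivative `∂f/∂u_j` at `u`, entrywise. -/
noncomputable def partialDerivU {n : ℕ} (j : Fin n)
    (f : (Fin n → ℂ) → Matrix (Fin n) (Fin n) ℂ) (u : Fin n → ℂ) :
    Matrix (Fin n) (Fin n) ℂ :=
  matrixDeriv (fun t => f (Function.update u j t)) (u j)

/-- The coefficient `ω₀(z,u) = Λ + A(u)/z`, where `Λ = diag(u_1,…,u_n)`. -/
noncomputable def omegaZero {n : ℕ} (A : (Fin n → ℂ) → Matrix (Fin n) (Fin n) ℂ)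
    (z : ℂ) (u : Fin n → ℂ) : Matrix (Fin n) (Fin n) ℂ :=
  Matrix.diagonal u + z⁻¹ • A u

/-- Complete (Frobenius) integrability `dω = ω ∧ ω` on `(ℂ ∖ {0}) × U` of
`ω = ω₀ dz + ∑ ω_j du_j`, written in components. -/
structure IsCompletelyIntegrable {n : ℕ} (U : Set (Fin n → ℂ))
    (A : (Fin n → ℂ) → Matrix (Fin n) (Fin n) ℂ)
    (ω : Fin n → ℂ → (Fin n → ℂ) → Matrix (Fin n) (Fin n) ℂ) : Prop where
  comm_zu : ∀ z : ℂ, z ≠ 0 → ∀ u ∈ U, ∀ j : Fin n,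
    matrixDeriv (fun s => ω j s u) z + ω j z u * omegaZero A z u
      = partialDerivU j (omegaZero A z) u + omegaZero A z u * ω j z u
  comm_uu : ∀ z : ℂ, z ≠ 0 → ∀ u ∈ U, ∀ i j : Fin n, i ≠ j →
    partialDerivU i (ω j z) u + ω j z u * ω i z u
      = partialDerivU j (ω i z) u + ω i z u * ω j z u

/-- `Y` is a fundamental matrix solution on `𝓡 × U` of `dY = ωY`, `ω = ω₀ dz + ∑ ω_j du_j`.
The universal covering `𝓡` of `ℂ ∖ {0}` is realised as `exp : ℂ → ℂ ∖ {0}`: the point of `𝓡`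
with coordinate `ζ` (`= log z`) lies over `z = exp ζ`, so that `∂/∂z = exp (-ζ) ∂/∂ζ`. -/
structure IsFundamentalSolution {n : ℕ} (U : Set (Fin n → ℂ))
    (A : (Fin n → ℂ) → Matrix (Fin n) (Fin n) ℂ)
    (ω : Fin n → ℂ → (Fin n → ℂ) → Matrix (Fin n) (Fin n) ℂ)
    (Y : ℂ → (Fin n → ℂ) → Matrix (Fin n) (Fin n) ℂ) : Prop where
  holomorphic : HolomorphicMatrixOn (fun p : ℂ × (Fin n → ℂ) => Y p.1 p.2) (Set.univ ×ˢ U)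
  invertible : ∀ ζ : ℂ, ∀ u ∈ U, IsUnit (Y ζ u)
  deriv_z : ∀ ζ : ℂ, ∀ u ∈ U,
    Complex.exp (-ζ) • matrixDeriv (fun s => Y s u) ζ
      = omegaZero A (Complex.exp ζ) u * Y ζ u
  deriv_u : ∀ ζ : ℂ, ∀ u ∈ U, ∀ j : Fin n,
    partialDerivU j (Y ζ) u = ω j (Complex.exp ζ) u * Y ζ u

/-- `J` is a Jordan matrix: block diagonal with (upper) Jordan blocks. Equivalently, `J` is upper
bidiagonal, its superdiagonal entries are `0` or `1`, and a superdiagonal entry `1` joins equal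
diagonal entries. -/
structure IsJordanMatrix {n : ℕ} (J : Matrix (Fin n) (Fin n) ℂ) : Prop where
  bidiagonal : ∀ i j : Fin n, j ≠ i → (j : ℕ) ≠ i + 1 → J i j = 0
  superdiagonal : ∀ i j : Fin n, (j : ℕ) = i + 1 → J i j = 0 ∨ (J i j = 1 ∧ J i i = J j j)

/-- The shape of the Levelt exponents `D = diag(d)` and `L`. There is a splitting of the indices
into `ℓ` nonempty consecutive blocks (`b i` is the block of the index `i`) such that
`L = L_1 ⊕ ⋯ ⊕ L_ℓ` with `L_q` upper triangular with the only eigenvalue `σ_q`,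
`0 ≤ Re σ_q < 1`, the `σ_q` are distinct, and `d` is non-increasing in each block. -/
def IsLeveltExponents {n : ℕ} (d : Fin n → ℤ) (L : Matrix (Fin n) (Fin n) ℂ) : Prop :=
  ∃ (ℓ : ℕ) (b : Fin n → Fin ℓ) (σ : Fin ℓ → ℂ),
    Monotone b ∧ Function.Surjective b ∧ Function.Injective σ ∧
    (∀ q, 0 ≤ (σ q).re ∧ (σ q).re < 1) ∧
    (∀ i j, b i ≠ b j → L i j = 0) ∧
    (∀ i j, j < i → L i j = 0) ∧
    (∀ i, L i i = σ (b i)) ∧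
    (∀ i j, b i = b j → i ≤ j → d j ≤ d i)

/-- `z^D` for a diagonal matrix `D = diag(d)` of integers and `z ≠ 0`. -/
noncomputable def zpowDiag {n : ℕ} (d : Fin n → ℤ) (z : ℂ) : Matrix (Fin n) (Fin n) ℂ :=
  Matrix.diagonal fun i => z ^ d i

/-- `D + z^D L z^{-D}`, for `z ≠ 0`. -/
noncomputable def leveltResidue {n : ℕ} (d : Fin n → ℤ) (L : Matrix (Fin n) (Fin n) ℂ)
    (z : ℂ) : Matrix (Fin n) (Fin n) ℂ :=
  Matrix.diagonal (fun i => (d i : ℂ)) + zpowDiag d z * L * zpowDiag (-d) z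

/-- For one value of the parameters, with residue matrix `A`: the function `Y` on `𝓡` is in Levelt
form `Y = Ŷ(z) z^D z^L`, `Ŷ(z) = G (I + ∑_{j ≥ 1} Ψ_j z^j)` at `z = 0`, with exponents
`D = diag(d)` and `L`, and `G` puts `A` in the Jordan form `J`. On `𝓡`, with `ζ = log z`,
one has `z^L = exp (ζ L)`. -/
structure IsLeveltForm {n : ℕ} (A G : Matrix (Fin n) (Fin n) ℂ)
    (Ψ : ℕ → Matrix (Fin n) (Fin n) ℂ) (d : Fin n → ℤ) (L J : Matrix (Fin n) (Fin n) ℂ)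
    (Yhat Y : ℂ → Matrix (Fin n) (Fin n) ℂ) : Prop where
  factorization : ∀ ζ : ℂ,
    Y ζ = Yhat (Complex.exp ζ) * zpowDiag d (Complex.exp ζ) * NormedSpace.exp (ζ • L)
  series : ∀ z : ℂ, ∃ S : Matrix (Fin n) (Fin n) ℂ,
    HasSum (fun j : ℕ => z ^ (j + 1) • Ψ (j + 1)) S ∧ Yhat z = G * (1 + S)
  isUnit_G : IsUnit G
  isJordan : IsJordanMatrix J
  conj_eq : G⁻¹ * A * G = J
  exponents : IsLeveltExponents d L
  /-- The eigenvalues of `A`, with multiplicity, are the `d_{q,s} + σ_q`. -/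
  eigenvalues : A.charpoly = ∏ i, (Polynomial.X - Polynomial.C ((d i : ℂ) + L i i))
  /-- `Ŷ(z) (D + z^D L z^{-D}) Ŷ(z)⁻¹` is holomorphic at `z = 0` with value `A` there. -/
  analytic_bracket : ∀ a b, AnalyticAt ℂ
    (Function.update (fun z => (Yhat z * leveltResidue d L z * (Yhat z)⁻¹) a b) 0 (A a b)) 0
  tendsto_bracket :
    Filter.Tendsto (fun z => Yhat z * leveltResidue d L z * (Yhat z)⁻¹) (𝓝[≠] 0) (𝓝 A)
  tendsto_conj :
    Filter.Tendsto (fun z => G * leveltResidue d L z * G⁻¹) (𝓝[≠] 0) (𝓝 A)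
  tendsto_residue : Filter.Tendsto (leveltResidue d L) (𝓝[≠] 0) (𝓝 J)

/-! The coefficients `ω_j` have no pole at `z = 0`. For each fixed `z`, including `z = 0`, the form
`∑ ω_j du_j` is therefore a holomorphic connection on the polydisc, flat by the `du_i ∧ du_j` part
of integrability. Let `H(z,u)` be its parallel transport from the centre along segments. It is
holomorphic on `ℂ × 𝔻`, invertible, equal to `1` at the centre, and satisfies `∂H/∂u_j = ω_j H`
(`fderiv_transport`).

The `dz ∧ du_j` part, multiplied by `z`, says that the connection commutes with `z∂_z - Q`, where `Q
= zΛ + A`. Hence `H` intertwines this operator at the centre with the same operator at `u`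
(`transport_intertwines`). Multiplying by `H` thus turns a solution of the single equation `z F' =
Q(z,u⁰) F` into a solution of the whole system. At `z = 0` the same relation reads `H A(u⁰) = A(u)
H`. So the exponents and the Jordan form found at `u⁰` serve for every `u`.

At `u⁰`, `A(u⁰)` is put in Jordan form `J` with suitably sorted eigenvalues
(`exists_isJordanMatrix`). A power series gauge transformation `P` then removes all nonresonant
terms (`exists_formal_levelt`). Because the gauged coefficient is a polynomial, the recursion makes
`P` entire. Resonance confines the `(i,j)` entry of that coefficient to the power `z^(d_i - d_j)`,
which is exactly the form `D + z^D L z^{-D}` (`exists_levelt_normalForm`). The solution is `Y = H G₀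
P z^D z^L`, with `Ŷ = H G₀ P` and `G = H(0,·) G₀`. -/

/-! ### Holomorphic functions of several variables -/

section SeveralVariables

variable {E F : Type*} [NormedAddCommGroup E] [NormedSpace ℂ E] [NormedAddCommGroup F]
  [NormedSpace ℂ F]

/-- Cauchy's estimate for the Fréchet derivative. -/
theorem norm_fderiv_le_of_forall_mem_ball {f : E → F} {x : E} {r M : ℝ} (hr : 0 < r)
    (hf : DifferentiableOn ℂ f (Metric.ball x r)) (hM : ∀ y ∈ Metric.ball x r, ‖f y‖ ≤ M) :
    ‖fderiv ℂ f x‖ ≤ 2 * M / r := by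
  have hM0 : 0 ≤ M := (norm_nonneg _).trans (hM x (Metric.mem_ball_self hr))
  have hd : DifferentiableAt ℂ f x := hf.differentiableAt (Metric.ball_mem_nhds x hr)
  refine hd.hasFDerivAt.le_of_lip' (by positivity) ?_
  filter_upwards [Metric.ball_mem_nhds x hr] with y hy
  have hmaps : Set.MapsTo f (Metric.ball x r) (Metric.closedBall (f x) (2 * M)) := by
    intro z hz
    rw [Metric.mem_closedBall, dist_eq_norm]
    calc ‖f z - f x‖ ≤ ‖f z‖ + ‖f x‖ := norm_sub_le _ _
      _ ≤ 2 * M := by linarith [hM z hz, hM x (Metric.mem_ball_self hr)]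
  simpa [dist_eq_norm] using Complex.dist_le_div_mul_dist_of_mapsTo_ball hf hmaps hy

/-- A locally uniform limit of holomorphic functions is holomorphic. -/
theorem differentiableOn_of_forall_tendstoUniformlyOn [CompleteSpace F] {f : ℕ → E → F}
    {g : E → F} {U : Set E} (hU : IsOpen U) (hf : ∀ n, DifferentiableOn ℂ (f n) U)
    (h : ∀ x ∈ U, ∃ V ∈ 𝓝 x, TendstoUniformlyOn f g Filter.atTop V) : DifferentiableOn ℂ g U := by
  intro x hx
  obtain ⟨V, hV, hunif⟩ := h x hx
  obtain ⟨r, hr, hball⟩ : ∃ r > 0, Metric.ball x (2 * r) ⊆ V ∩ U := by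
    obtain ⟨r, hr, h⟩ := Metric.mem_nhds_iff.1 (Filter.inter_mem hV (hU.mem_nhds hx))
    exact ⟨r / 2, by positivity, by simpa [mul_div_cancel₀] using h⟩
  have hsub : ∀ y ∈ Metric.ball x r, Metric.ball y r ⊆ V ∩ U := by
    intro y hy
    refine (Metric.ball_subset_ball' ?_).trans hball
    have := Metric.mem_ball.1 hy
    linarith
  have hcauchy : UniformCauchySeqOn (fun n => fderiv ℂ (f n)) Filter.atTop (Metric.ball x r) := by
    rw [Metric.uniformCauchySeqOn_iff]
    intro ε hε
    -- Cauchy's estimate turns the bound `ε r / 4` on differences into `ε / 2` on their derivatives.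
    obtain ⟨N, hN⟩ := Metric.uniformCauchySeqOn_iff.1 hunif.uniformCauchySeqOn (ε * r / 4)
      (by positivity)
    refine ⟨N, fun m hm n hn y hy => ?_⟩
    have hd : ∀ k, DifferentiableOn ℂ (f k) (Metric.ball y r) := fun k =>
      (hf k).mono fun z hz => (hsub y hy hz).2
    have hda : ∀ k, DifferentiableAt ℂ (f k) y := fun k =>
      (hd k).differentiableAt (Metric.ball_mem_nhds y hr)
    have := norm_fderiv_le_of_forall_mem_ball (f := f m - f n) (M := ε * r / 4) hr
      ((hd m).sub (hd n))
      (fun z hz => by simpa [dist_eq_norm] using (hN m hm n hn z (hsub y hy hz).1).le)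
    rw [fderiv_sub (hda m) (hda n)] at this
    rw [dist_eq_norm]
    refine this.trans_lt ?_
    rw [div_lt_iff₀ hr]
    nlinarith
  have hlim : ∀ y ∈ Metric.ball x r, ∃ l, Filter.Tendsto (fun n => fderiv ℂ (f n) y)
      Filter.atTop (𝓝 l) := fun y hy =>
    cauchySeq_tendsto_of_complete (hcauchy.cauchySeq hy)
  choose! g' hg' using hlim
  have hunif' := hcauchy.tendstoUniformlyOn_of_tendsto hg'
  have hsub' : Metric.ball x r ⊆ V ∩ U := hsub x (Metric.mem_ball_self hr)
  refine (hasFDerivAt_of_tendstoUniformlyOn (f := f) Metric.isOpen_ball hunif' (fun n y hy => ?_)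
    (fun y hy => ?_) (Metric.mem_ball_self hr)).differentiableAt.differentiableWithinAt
  · exact ((hf n).differentiableAt (hU.mem_nhds (hsub' hy).2)).hasFDerivAt
  · exact hunif.tendsto_at (hsub' hy).1

/-- The second order Taylor bound for a holomorphic function. -/
theorem norm_sub_sub_fderiv_le [CompleteSpace F] {f : E → F} {x : E} {r M : ℝ} (hr : 0 < r)
    (hf : DifferentiableOn ℂ f (Metric.ball x r)) (hM : ∀ y ∈ Metric.ball x r, ‖f y‖ ≤ M)
    {w : E} (hw : ‖w‖ < r) {t : ℂ} (ht : ‖t‖ < 1) :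
    ‖f (x + t • w) - f x - t • fderiv ℂ f x w‖ ≤ 4 * M * ‖t‖ ^ 2 := by
  have hM0 : 0 ≤ M := (norm_nonneg _).trans (hM x (Metric.mem_ball_self hr))
  set φ : ℂ → F := fun s => f (x + s • w) with hφ
  have hin : ∀ s ∈ Metric.ball (0 : ℂ) 1, x + s • w ∈ Metric.ball x r := by
    intro s hs
    rw [mem_ball_zero_iff] at hs
    rw [Metric.mem_ball, dist_eq_norm, add_sub_cancel_left, norm_smul]
    nlinarith [norm_nonneg w, norm_nonneg s]
  have hφd : DifferentiableOn ℂ φ (Metric.ball 0 1) :=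
    hf.comp (by fun_prop) hin
  have hφ0 : φ 0 = f x := by simp [hφ]
  have hder : deriv φ 0 = fderiv ℂ f x w := by
    have h1 : HasFDerivAt f (fderiv ℂ f x) (x + (0 : ℂ) • w) := by
      simpa using (hf.differentiableAt (Metric.ball_mem_nhds x hr)).hasFDerivAt
    have h2 : HasDerivAt (fun s : ℂ => x + s • w) w 0 := by
      simpa using ((hasDerivAt_id (0 : ℂ)).smul_const w).const_add x
    exact (h1.comp_hasDerivAt (0 : ℂ) h2).deriv
  have hmaps : Set.MapsTo φ (Metric.ball 0 1) (Metric.closedBall (φ 0) (2 * M)) := by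
    intro s hs
    rw [Metric.mem_closedBall, dist_eq_norm]
    have h1 := hM _ (hin s hs)
    have h2 := hM _ (Metric.mem_ball_self hr)
    calc ‖φ s - φ 0‖ ≤ ‖φ s‖ + ‖φ 0‖ := norm_sub_le _ _
      _ ≤ 2 * M := by rw [hφ0]; simp only [hφ]; linarith
  -- The Schwarz lemma is used twice on the slice `φ`: it bounds the slope by `2M`, and then,
  -- applied to the slope, bounds its variation by `4M‖t‖`. One more factor `t` gives the quadratic
  -- remainder.
  have hds : ∀ s ∈ Metric.ball (0 : ℂ) 1, ‖dslope φ 0 s‖ ≤ 2 * M := fun s hs => by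
    simpa using Complex.norm_dslope_le_div_of_mapsTo_ball hφd hmaps hs
  have hdsd : DifferentiableOn ℂ (dslope φ 0) (Metric.ball 0 1) :=
    (Complex.differentiableOn_dslope (Metric.ball_mem_nhds _ one_pos)).2 hφd
  have hmaps' : Set.MapsTo (dslope φ 0) (Metric.ball 0 1)
      (Metric.closedBall (dslope φ 0 0) (4 * M)) := by
    intro s hs
    rw [Metric.mem_closedBall, dist_eq_norm]
    have h1 := hds s hs
    have h2 := hds 0 (Metric.mem_ball_self one_pos)
    calc ‖dslope φ 0 s - dslope φ 0 0‖ ≤ ‖dslope φ 0 s‖ + ‖dslope φ 0 0‖ := norm_sub_le _ _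
      _ ≤ 4 * M := by linarith
  have htb : t ∈ Metric.ball (0 : ℂ) 1 := by simpa using ht
  have key := Complex.dist_le_div_mul_dist_of_mapsTo_ball hdsd hmaps' htb
  rw [dslope_same, hder, dist_eq_norm, dist_eq_norm, sub_zero, div_one] at key
  have hid : f (x + t • w) - f x - t • fderiv ℂ f x w
      = t • (dslope φ 0 t - fderiv ℂ f x w) := by
    have := sub_smul_dslope φ 0 t
    rw [sub_zero, hφ0] at this
    rw [smul_sub, this]
  rw [hid, norm_smul]
  nlinarith [norm_nonneg t]

/-- The directional derivative is a locally uniform limit of holomorphic difference quotients; the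
second order Taylor bound supplies the rate. -/
theorem differentiableOn_fderiv_apply [CompleteSpace F] {f : E → F} {U : Set E} (hU : IsOpen U)
    (hf : DifferentiableOn ℂ f U) (w : E) :
    DifferentiableOn ℂ (fun x => fderiv ℂ f x w) U := by
  intro x hx
  obtain ⟨R, hR, hRU, M, hM⟩ : ∃ R > 0, Metric.ball x R ⊆ U ∧
      ∃ M, ∀ y ∈ Metric.ball x R, ‖f y‖ ≤ M := by
    have hc : ContinuousAt (fun y => ‖f y‖) x :=
      (hf.continuousOn.continuousAt (hU.mem_nhds hx)).norm
    have := hc.eventually (gt_mem_nhds (lt_add_one _))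
    obtain ⟨R, hR, h⟩ := Metric.mem_nhds_iff.1 (Filter.inter_mem (hU.mem_nhds hx) this)
    exact ⟨R, hR, fun y hy => (h hy).1, _, fun y hy => (h hy).2.le⟩
  have hM0 : 0 ≤ M := (norm_nonneg _).trans (hM x (Metric.mem_ball_self hR))
  set r := R / 2 with hr'
  have hr : 0 < r := by positivity
  have hsub : ∀ y ∈ Metric.ball x r, Metric.ball y r ⊆ Metric.ball x R := by
    intro y hy
    refine Metric.ball_subset_ball' ?_
    have := Metric.mem_ball.1 hy
    linarith
  obtain ⟨c, hc0, hc⟩ : ∃ c : ℝ, 0 < c ∧ ‖(c : ℂ) • w‖ < r := by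
    refine ⟨r / (‖w‖ + 1), by positivity, ?_⟩
    rw [norm_smul, Complex.norm_real, Real.norm_of_nonneg (by positivity), div_mul_eq_mul_div,
      div_lt_iff₀ (by positivity)]
    nlinarith [norm_nonneg w]
  set w' := (c : ℂ) • w
  -- The increments tend to `0`; the shift by `2` keeps them of norm `< 1` already at `m = 0`, as
  -- the Taylor bound requires.
  let q : ℕ → ℂ := fun m => ((m : ℂ) + 2)⁻¹
  have hqn : ∀ m, ‖q m‖ = ((m : ℝ) + 2)⁻¹ := fun m => by
    have : ((m : ℂ) + 2) = (((m : ℝ) + 2 : ℝ) : ℂ) := by push_cast; rfl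
    simp only [q, norm_inv, this, Complex.norm_real]
    rw [Real.norm_of_nonneg (by positivity)]
  have hq1 : ∀ m, ‖q m‖ < 1 := fun m => by
    rw [hqn]; exact inv_lt_one_of_one_lt₀ (by linarith [Nat.cast_nonneg (α := ℝ) m])
  have hq0 : ∀ m, q m ≠ 0 := fun m => by
    rw [← norm_ne_zero_iff, hqn]; positivity
  have key : DifferentiableOn ℂ (fun y => fderiv ℂ f y w') (Metric.ball x r) := by
    refine differentiableOn_of_forall_tendstoUniformlyOn
      (f := fun m y => (q m)⁻¹ • (f (y + q m • w') - f y)) Metric.isOpen_ball (fun m => ?_) ?_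
    · refine DifferentiableOn.const_smul (DifferentiableOn.sub ?_ ?_) _
      · refine hf.comp (by fun_prop) fun y hy => hRU (hsub y hy ?_)
        rw [Metric.mem_ball, dist_eq_norm, add_sub_cancel_left, norm_smul]
        nlinarith [norm_nonneg w', hq1 m, norm_nonneg (q m)]
      · exact hf.mono fun y hy => hRU (hsub y hy (Metric.mem_ball_self hr))
    · refine fun x' hx' => ⟨_, Metric.isOpen_ball.mem_nhds hx', ?_⟩
      rw [Metric.tendstoUniformlyOn_iff]
      intro ε hε
      have hlim : Filter.Tendsto (fun m : ℕ => 4 * M * ((m : ℝ) + 2)⁻¹) Filter.atTop (𝓝 0) := by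
        have := (tendsto_inv_atTop_zero.comp (Filter.tendsto_atTop_add_const_right _ (2 : ℝ)
          tendsto_natCast_atTop_atTop)).const_mul (4 * M)
        simpa using this
      filter_upwards [hlim.eventually (gt_mem_nhds hε)] with m hm y hy
      have := norm_sub_sub_fderiv_le hr (hf.mono ((hsub y hy).trans hRU))
        (fun z hz => hM z (hsub y hy hz)) hc (hq1 m)
      rw [dist_comm, dist_eq_norm]
      have hid : (q m)⁻¹ • (f (y + q m • w') - f y) - fderiv ℂ f y w'
          = (q m)⁻¹ • (f (y + q m • w') - f y - q m • fderiv ℂ f y w') := by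
        rw [smul_sub _ _ (q m • _), inv_smul_smul₀ (hq0 m)]
      rw [hid, norm_smul, norm_inv]
      refine lt_of_le_of_lt ?_ hm
      rw [← hqn m, inv_mul_le_iff₀ (norm_pos_iff.2 (hq0 m))]
      linarith
  have hw : (fun y => fderiv ℂ f y w) = fun y => (c : ℂ)⁻¹ • fderiv ℂ f y w' := by
    ext y
    have : (c : ℂ) ≠ 0 := by exact_mod_cast hc0.ne'
    simp only [w', map_smul]
    rw [inv_smul_smul₀ this]
  rw [hw]
  exact ((key.differentiableAt (Metric.ball_mem_nhds x hr)).const_smul _).differentiableWithinAt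

/-- A holomorphic function of several variables is smooth. -/
theorem DifferentiableOn.contDiffOn_of_isOpen [FiniteDimensional ℂ E] [CompleteSpace F] {f : E → F}
    {U : Set E} (hf : DifferentiableOn ℂ f U) (hU : IsOpen U) (n : ℕ) : ContDiffOn ℂ n f U := by
  induction n generalizing f with
  | zero => exact contDiffOn_zero.2 hf.continuousOn
  | succ n ih =>
    push_cast
    rw [contDiffOn_succ_iff_fderiv_of_isOpen hU]
    refine ⟨hf, fun h => absurd h (by simp), ?_⟩
    rw [contDiffOn_clm_apply]
    exact fun w => ih (differentiableOn_fderiv_apply hU hf w)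

theorem DifferentiableOn.fderiv_of_isOpen [FiniteDimensional ℂ E] [CompleteSpace F] {f : E → F}
    {U : Set E} (hf : DifferentiableOn ℂ f U) (hU : IsOpen U) :
    DifferentiableOn ℂ (fderiv ℂ f) U := by
  have := (contDiffOn_succ_iff_fderiv_of_isOpen (n := 1) hU).1
    (by exact_mod_cast hf.contDiffOn_of_isOpen hU 2)
  exact this.2.2.differentiableOn (by simp)

/-- An integral depending holomorphically on parameters. -/
theorem differentiableOn_intervalIntegral [FiniteDimensional ℂ E] [CompleteSpace F]
    {G : E × ℂ → F} {O : Set (E × ℂ)} (hO : IsOpen O) (hG : DifferentiableOn ℂ G O) {W : Set E}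
    (hW : ∀ x ∈ W, ∀ s ∈ Set.Icc (0 : ℝ) 1, (x, (s : ℂ)) ∈ O) :
    DifferentiableOn ℂ (fun x => ∫ s in (0 : ℝ)..1, G (x, s)) W := by
  intro x hx
  have hfd := hG.fderiv_of_isOpen hO
  let c : E × ℝ → E × ℂ := fun p => (p.1, (p.2 : ℂ))
  have hcc : Continuous c := by fun_prop
  have hO' : IsOpen (c ⁻¹' O) := hO.preimage hcc
  obtain ⟨M, hM⟩ : ∃ M, ∀ s ∈ Set.Icc (0 : ℝ) 1, ‖fderiv ℂ G (c (x, s))‖ ≤ M := by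
    refine isCompact_Icc.exists_bound_of_continuousOn ?_
    exact hfd.continuousOn.comp (by fun_prop) fun s hs => hW x hx s hs
  have hopen : IsOpen (c ⁻¹' O ∩ (fun p => ‖fderiv ℂ G (c p)‖) ⁻¹' Set.Iio (M + 1)) :=
    (hfd.continuousOn.comp hcc.continuousOn (fun p hp => hp)).norm.isOpen_inter_preimage hO'
      isOpen_Iio
  -- Compactness of `[0,1]` gives one neighbourhood of `x` on which the derivative is bounded
  -- uniformly in `s`, so that dominated differentiation applies.
  obtain ⟨u, v, hu, -, hxu, hv, huv⟩ := generalized_tube_lemma (isCompact_singleton (x := x))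
    (isCompact_Icc (a := (0 : ℝ)) (b := 1)) hopen (by
      rintro ⟨y, s⟩ ⟨rfl, hs⟩
      exact ⟨hW _ hx s hs, lt_of_le_of_lt (hM s hs) (lt_add_one M)⟩)
  have hmem : ∀ y ∈ u, ∀ s ∈ Set.Icc (0 : ℝ) 1, (y, (s : ℂ)) ∈ O ∧
      ‖fderiv ℂ G (y, (s : ℂ))‖ < M + 1 := fun y hy s hs =>
    huv (Set.mk_mem_prod hy (hv hs))
  have hunhds : u ∈ 𝓝 x := hu.mem_nhds (hxu rfl)
  have hcont : ∀ y ∈ u, ContinuousOn (fun s : ℝ => G (y, (s : ℂ))) (Set.Icc 0 1) := fun y hy =>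
    hG.continuousOn.comp (by fun_prop) fun s hs => (hmem y hy s hs).1
  have hIoc : Set.uIoc (0 : ℝ) 1 = Set.Ioc 0 1 := Set.uIoc_of_le zero_le_one
  have hle : Set.Ioc (0 : ℝ) 1 ⊆ Set.Icc 0 1 := Set.Ioc_subset_Icc_self
  refine (intervalIntegral.hasFDerivAt_integral_of_dominated_of_fderiv_le
    (F' := fun y s => (fderiv ℂ G (y, (s : ℂ))).comp (ContinuousLinearMap.inl ℂ E ℂ))
    (bound := fun _ => M + 1) hunhds ?_ ?_ ?_ ?_ ?_ ?_).differentiableAt.differentiableWithinAt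
  · filter_upwards [hunhds] with y hy
    rw [hIoc]
    exact ((hcont y hy).mono hle).aestronglyMeasurable measurableSet_Ioc
  · exact ((hcont x (hxu rfl)).mono (by rw [Set.uIcc_of_le zero_le_one])).intervalIntegrable
  · rw [hIoc]
    refine ContinuousOn.aestronglyMeasurable ?_ measurableSet_Ioc
    refine ContinuousOn.clm_comp (hfd.continuousOn.comp (by fun_prop) fun s hs =>
      (hmem x (hxu rfl) s (hle hs)).1) continuousOn_const
  · refine Filter.Eventually.of_forall fun s hs y hy => ?_
    rw [hIoc] at hs
    refine (ContinuousLinearMap.opNorm_comp_le _ _).trans ?_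
    have h1 := (hmem y hy s (hle hs)).2.le
    have h2 := ContinuousLinearMap.norm_inl_le_one ℂ E ℂ
    nlinarith [norm_nonneg (fderiv ℂ G (y, (s : ℂ))), norm_nonneg (ContinuousLinearMap.inl ℂ E ℂ)]
  · exact intervalIntegrable_const
  · refine Filter.Eventually.of_forall fun s hs y hy => ?_
    rw [hIoc] at hs
    have h1 : HasFDerivAt G (fderiv ℂ G (y, (s : ℂ))) (y, (s : ℂ)) :=
      (hG.differentiableAt (hO.mem_nhds (hmem y hy s (hle hs)).1)).hasFDerivAt
    exact h1.comp y (hasFDerivAt_prodMk_left y (s : ℂ))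

end SeveralVariables

/-! ### Linear ordinary differential equations: uniqueness -/

section LinearODE

variable {𝔸 : Type*} [NormedRing 𝔸] [NormedAlgebra ℝ 𝔸]

/-- This is Grönwall's inequality, the coefficient being bounded on the compact interval. -/
theorem eq_zero_of_hasDerivAt_mul_of_left {a f : ℝ → 𝔸} (ha : ContinuousOn a (Set.Icc 0 1))
    (hf : ∀ t ∈ Set.Icc (0 : ℝ) 1, HasDerivAt f (a t * f t) t) (h0 : f 0 = 0) :
    ∀ t ∈ Set.Icc (0 : ℝ) 1, f t = 0 := by
  obtain ⟨K, hK⟩ := isCompact_Icc.exists_bound_of_continuousOn ha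
  refine eq_zero_of_abs_deriv_le_mul_abs_self_of_eq_zero_right (f' := fun t => a t * f t) (K := K)
    (fun t ht => (hf t ht).continuousAt.continuousWithinAt)
    (fun t ht => (hf t ⟨ht.1, ht.2.le⟩).hasDerivWithinAt) h0 fun t ht => ?_
  exact (norm_mul_le _ _).trans
    (mul_le_mul_of_nonneg_right (hK t ⟨ht.1, ht.2.le⟩) (norm_nonneg _))

theorem eq_zero_of_hasDerivAt_mul_of_right {a f : ℝ → 𝔸} (ha : ContinuousOn a (Set.Icc 0 1))
    (hf : ∀ t ∈ Set.Icc (0 : ℝ) 1, HasDerivAt f (a t * f t) t) (h1 : f 1 = 0) : f 0 = 0 := by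
  have hmem : ∀ t ∈ Set.Icc (0 : ℝ) 1, 1 - t ∈ Set.Icc (0 : ℝ) 1 := fun t ht =>
    ⟨by linarith [ht.2], by linarith [ht.1]⟩
  have := eq_zero_of_hasDerivAt_mul_of_left (a := fun t => -a (1 - t)) (f := fun t => f (1 - t))
    ((ha.comp (by fun_prop) hmem).neg) (fun t ht => ?_) (by simpa using h1) 1 (by simp)
  · simpa using this
  · have h2 : HasDerivAt (fun t : ℝ => 1 - t) (-1) t := by
      simpa using (hasDerivAt_id t).const_sub 1
    have h3 := (hf (1 - t) (hmem t ht)).scomp t h2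
    rw [neg_one_smul, ← neg_mul] at h3
    exact h3

end LinearODE

/-! ### Parallel transport for a holomorphic connection with parameters -/

section ParallelTransport

variable {P V 𝔸 : Type*} [NormedAddCommGroup P] [NormedSpace ℂ P] [NormedAddCommGroup V]
  [NormedSpace ℂ V] [NormedRing 𝔸] [NormedAlgebra ℂ 𝔸]

/-- The terms of the iterated integral (Dyson) series for the parallel transport of the
connection `Ω` along the segments which start at the origin. -/
noncomputable def transportTerm (Ω : P × V → V →L[ℂ] 𝔸) : ℕ → P × V → 𝔸
  | 0 => fun _ => 1
  | m + 1 => fun x => ∫ s in (0 : ℝ)..1,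
      Ω (x.1, (s : ℂ) • x.2) x.2 * transportTerm Ω m (x.1, (s : ℂ) • x.2)

/-- The parallel transport of the connection `Ω` along the segments which start at the origin. -/
noncomputable def transport (Ω : P × V → V →L[ℂ] 𝔸) (x : P × V) : 𝔸 :=
  ∑' m, transportTerm Ω m x

variable {Ω : P × V → V →L[ℂ] 𝔸} {U : Set V}

theorem transport_zero (p : P) : transport Ω (p, 0) = 1 := by
  rw [transport, tsum_eq_single 0]
  · rfl
  · rintro (_ | m) hm
    · exact absurd rfl hm
    · simp [transportTerm]

theorem differentiableOn_transportTerm [FiniteDimensional ℂ P] [FiniteDimensional ℂ V]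
    [CompleteSpace 𝔸] (hU : IsOpen U) (hstar : ∀ v ∈ U, ∀ s ∈ Set.Icc (0 : ℝ) 1, (s : ℂ) • v ∈ U)
    (hΩ : DifferentiableOn ℂ Ω (Set.univ ×ˢ U)) (m : ℕ) :
    DifferentiableOn ℂ (transportTerm Ω m) (Set.univ ×ˢ U) := by
  induction m with
  | zero => exact differentiableOn_const _
  | succ m ih =>
    let c : (P × V) × ℂ → P × V := fun y => (y.1.1, y.2 • y.1.2)
    have hc : Differentiable ℂ c := by fun_prop
    have hO : IsOpen (c ⁻¹' (Set.univ ×ˢ U)) := (isOpen_univ.prod hU).preimage hc.continuous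
    refine differentiableOn_intervalIntegral
      (G := fun y => Ω (c y) y.1.2 * transportTerm Ω m (c y)) hO ?_ fun x hx s hs => ?_
    · refine DifferentiableOn.mul ?_ (ih.comp hc.differentiableOn fun y hy => hy)
      exact (hΩ.comp hc.differentiableOn fun y hy => hy).clm_apply (by fun_prop)
    · exact ⟨trivial, hstar _ hx.2 s hs⟩

/-- The bound is stated along the whole segment because the induction integrates it: `∫ s^m =
1/(m+1)` builds up the factorial. The factor `‖1‖` is there because the norm of the unit is not
normalised. -/
theorem norm_transportTerm_le [FiniteDimensional ℂ P] [FiniteDimensional ℂ V] [CompleteSpace 𝔸]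
    {C : ℝ} {p : P} {v : V} (hC : ∀ s ∈ Set.Icc (0 : ℝ) 1, ‖Ω (p, (s : ℂ) • v)‖ ≤ C) (m : ℕ) :
    ∀ t ∈ Set.Icc (0 : ℝ) 1, ‖transportTerm Ω m (p, (t : ℂ) • v)‖
      ≤ ‖(1 : 𝔸)‖ * ((C * ‖v‖ * t) ^ m / m.factorial) := by
  have hC0 : 0 ≤ C := (norm_nonneg _).trans (hC 0 (by simp))
  induction m with
  | zero => simp [transportTerm]
  | succ m ih =>
    intro t ht
    have hst : ∀ s ∈ Set.Icc (0 : ℝ) 1, s * t ∈ Set.Icc (0 : ℝ) 1 := fun s hs =>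
      ⟨mul_nonneg hs.1 ht.1, mul_le_one₀ hs.2 ht.1 ht.2⟩
    set K : ℝ := ‖(1 : 𝔸)‖ * ((C * ‖v‖ * t) ^ (m + 1) / m.factorial)
    have hint : ∫ s in (0 : ℝ)..1, K * s ^ m
        = ‖(1 : 𝔸)‖ * ((C * ‖v‖ * t) ^ (m + 1) / (m + 1).factorial) := by
      rw [intervalIntegral.integral_const_mul, integral_pow, Nat.factorial_succ]
      push_cast
      simp only [K]
      field_simp
      simp
    rw [← hint]
    refine intervalIntegral.norm_integral_le_of_norm_le zero_le_one
      (Filter.Eventually.of_forall fun s hs => ?_)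
      (Continuous.intervalIntegrable (by fun_prop) _ _)
    have hs' : s ∈ Set.Icc (0 : ℝ) 1 := ⟨hs.1.le, hs.2⟩
    have e : (s : ℂ) • (t : ℂ) • v = ((s * t : ℝ) : ℂ) • v := by push_cast; rw [mul_smul]
    simp only [e]
    have h1 := hC _ (hst s hs')
    have h2 := ih _ (hst s hs')
    have h3 : ‖(t : ℂ) • v‖ = t * ‖v‖ := by
      rw [norm_smul, Complex.norm_real, Real.norm_of_nonneg ht.1]
    calc _ ≤ ‖Ω (p, ((s * t : ℝ) : ℂ) • v) ((t : ℂ) • v)‖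
          * ‖transportTerm Ω m (p, ((s * t : ℝ) : ℂ) • v)‖ := norm_mul_le _ _
      _ ≤ (C * (t * ‖v‖)) * (‖(1 : 𝔸)‖ * ((C * ‖v‖ * (s * t)) ^ m / m.factorial)) := by
          refine mul_le_mul ?_ h2 (norm_nonneg _)
            (mul_nonneg hC0 (mul_nonneg ht.1 (norm_nonneg _)))
          rw [← h3]
          exact (ContinuousLinearMap.le_opNorm _ _).trans
            (mul_le_mul_of_nonneg_right h1 (norm_nonneg _))
      _ = K * s ^ m := by simp only [K]; ring

/-- The tube lemma around the compact segment bounds `Ω` uniformly for all nearby end points, which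
gives a majorant by the exponential series. -/
theorem exists_ball_norm_transportTerm_le [FiniteDimensional ℂ P] [FiniteDimensional ℂ V]
    [CompleteSpace 𝔸] (hU : IsOpen U) (hstar : ∀ v ∈ U, ∀ s ∈ Set.Icc (0 : ℝ) 1, (s : ℂ) • v ∈ U)
    (hΩ : DifferentiableOn ℂ Ω (Set.univ ×ˢ U)) {x : P × V} (hx : x ∈ Set.univ ×ˢ U) :
    ∃ r > 0, ∃ C : ℝ, Metric.ball x r ⊆ Set.univ ×ˢ U ∧ ∀ y ∈ Metric.ball x r, ∀ m,
      ‖transportTerm Ω m y‖ ≤ ‖(1 : 𝔸)‖ * (C ^ m / m.factorial) := by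
  let c : (P × V) × ℝ → P × V := fun y => (y.1.1, (y.2 : ℂ) • y.1.2)
  have hc : Continuous c := by fun_prop
  have hO : IsOpen (Set.univ ×ˢ U : Set (P × V)) := isOpen_univ.prod hU
  obtain ⟨M, hM⟩ : ∃ M, ∀ s ∈ Set.Icc (0 : ℝ) 1, ‖Ω (c (x, s))‖ ≤ M :=
    isCompact_Icc.exists_bound_of_continuousOn
      (hΩ.continuousOn.comp (by fun_prop) fun s hs => ⟨trivial, hstar _ hx.2 s hs⟩)
  have hopen : IsOpen (c ⁻¹' (Set.univ ×ˢ U) ∩ (fun y => ‖Ω (c y)‖) ⁻¹' Set.Iio (M + 1)) :=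
    (hΩ.continuousOn.comp hc.continuousOn (fun p hp => hp)).norm.isOpen_inter_preimage
      (hO.preimage hc) isOpen_Iio
  obtain ⟨u, w, hu, -, hxu, hw, huw⟩ := generalized_tube_lemma (isCompact_singleton (x := x))
    (isCompact_Icc (a := (0 : ℝ)) (b := 1)) hopen (by
      rintro ⟨y, s⟩ ⟨rfl, hs⟩
      exact ⟨⟨trivial, hstar _ hx.2 s hs⟩, lt_of_le_of_lt (hM s hs) (lt_add_one M)⟩)
  obtain ⟨r, hr, hball⟩ := Metric.isOpen_iff.1 (hu.inter hO) x ⟨hxu rfl, hx⟩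
  refine ⟨r, hr, (M + 1) * (‖x.2‖ + r), fun y hy => (hball hy).2, fun y hy m => ?_⟩
  have hb : ∀ s ∈ Set.Icc (0 : ℝ) 1, ‖Ω (y.1, (s : ℂ) • y.2)‖ ≤ M + 1 := fun s hs =>
    (huw (Set.mk_mem_prod (hball hy).1 (hw hs))).2.le
  have hM0 : 0 ≤ M + 1 := (norm_nonneg _).trans (hb 0 (by simp))
  have h1 := norm_transportTerm_le hb m 1 (by simp)
  simp only [Complex.ofReal_one, one_smul, mul_one] at h1
  refine h1.trans ?_
  have hy2 : ‖y.2‖ ≤ ‖x.2‖ + r := by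
    have : ‖y.2 - x.2‖ ≤ ‖y - x‖ := norm_snd_le (y - x)
    rw [Metric.mem_ball, dist_eq_norm] at hy
    have := norm_le_norm_add_norm_sub' y.2 x.2
    linarith
  gcongr

/-- Rescaling the parameter turns the value at the point `t v` of the segment into an integral over
`[0,t]`, whose derivative at `t = 1` is the integrand. -/
theorem fderiv_transportTerm_succ [FiniteDimensional ℂ P] [FiniteDimensional ℂ V]
    [CompleteSpace 𝔸] (hU : IsOpen U) (hstar : ∀ v ∈ U, ∀ s ∈ Set.Icc (0 : ℝ) 1, (s : ℂ) • v ∈ U)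
    (hΩ : DifferentiableOn ℂ Ω (Set.univ ×ˢ U)) (m : ℕ) {x : P × V} (hx : x ∈ Set.univ ×ˢ U) :
    fderiv ℂ (transportTerm Ω (m + 1)) x (0, x.2) = Ω x x.2 * transportTerm Ω m x := by
  have hO : IsOpen (Set.univ ×ˢ U : Set (P × V)) := isOpen_univ.prod hU
  let c : ℝ → P × V := fun t => (x.1, (t : ℂ) • x.2)
  have hc : Continuous c := by fun_prop
  have hc1 : c 1 = x := by simp [c]
  have hcS : ∀ t ∈ Set.Icc (0 : ℝ) 1, c t ∈ Set.univ ×ˢ U := fun t ht =>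
    ⟨trivial, hstar _ hx.2 t ht⟩
  let q : ℝ → 𝔸 := fun s => Ω (c s) x.2 * transportTerm Ω m (c s)
  have hqc : ContinuousOn q (c ⁻¹' (Set.univ ×ˢ U)) := by
    refine ContinuousOn.mul ?_ ((differentiableOn_transportTerm hU hstar hΩ m).continuousOn.comp
      hc.continuousOn fun t ht => ht)
    exact (hΩ.continuousOn.comp hc.continuousOn fun t ht => ht).clm_apply continuousOn_const
  have hco : IsOpen (c ⁻¹' (Set.univ ×ˢ U)) := hO.preimage hc
  have hform : ∀ t : ℝ, transportTerm Ω (m + 1) (c t) = ∫ s in (0 : ℝ)..t, q s := by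
    intro t
    have h2 := intervalIntegral.smul_integral_comp_mul_right (a := 0) (b := 1) q t
    simp only [zero_mul, one_mul] at h2
    rw [← h2, ← intervalIntegral.integral_smul]
    simp only [transportTerm, c]
    refine intervalIntegral.integral_congr fun s _ => ?_
    simp only [q, c, smul_smul]
    push_cast
    rw [map_smul, smul_mul_assoc, Complex.coe_smul]
  have h1 : HasDerivAt (fun t => ∫ s in (0 : ℝ)..t, q s) (q 1) 1 := by
    have h01 : (1 : ℝ) ∈ c ⁻¹' (Set.univ ×ˢ U) := hcS 1 (by simp)
    refine intervalIntegral.integral_hasDerivAt_right ?_ ?_ ?_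
    · refine (hqc.mono ?_).intervalIntegrable
      rw [Set.uIcc_of_le zero_le_one]
      exact hcS
    · exact hqc.stronglyMeasurableAtFilter hco 1 h01
    · exact hqc.continuousAt (hco.mem_nhds h01)
  have h2 : HasDerivAt (fun t => transportTerm Ω (m + 1) (c t))
      (fderiv ℂ (transportTerm Ω (m + 1)) x (0, x.2)) 1 := by
    have hd : HasFDerivAt (transportTerm Ω (m + 1)) (fderiv ℂ (transportTerm Ω (m + 1)) x)
        (c 1) := by
      rw [hc1]
      exact ((differentiableOn_transportTerm hU hstar hΩ (m + 1)).differentiableAt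
        (hO.mem_nhds hx)).hasFDerivAt
    have hcd : HasDerivAt c (0, x.2) 1 := by
      refine (hasDerivAt_const _ _).prodMk ?_
      simpa using (Complex.ofRealCLM.hasDerivAt (x := (1 : ℝ))).smul_const x.2
    exact (hd.restrictScalars ℝ).comp_hasDerivAt (1 : ℝ) hcd
  simp only [hform] at h2
  have := h2.unique h1
  simpa only [q, hc1] using this

/-- On a ball of half the radius, Cauchy's estimate passes the exponential majorant on to the
derivatives, so the series may be differentiated termwise. -/
theorem hasFDerivAt_transport [FiniteDimensional ℂ P] [FiniteDimensional ℂ V]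
    [CompleteSpace 𝔸] (hU : IsOpen U) (hstar : ∀ v ∈ U, ∀ s ∈ Set.Icc (0 : ℝ) 1, (s : ℂ) • v ∈ U)
    (hΩ : DifferentiableOn ℂ Ω (Set.univ ×ˢ U)) {x : P × V} (hx : x ∈ Set.univ ×ˢ U) :
    Summable (fun m => transportTerm Ω m x) ∧ Summable (fun m => fderiv ℂ (transportTerm Ω m) x) ∧
    HasFDerivAt (transport Ω) (∑' m, fderiv ℂ (transportTerm Ω m) x) x := by
  obtain ⟨r, hr, C, hball, hb⟩ := exists_ball_norm_transportTerm_le hU hstar hΩ hx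
  have hsum : Summable fun m : ℕ => ‖(1 : 𝔸)‖ * (C ^ m / m.factorial) :=
    (Real.summable_pow_div_factorial C).mul_left _
  have hr2 : 0 < r / 2 := by positivity
  have hsub : ∀ y ∈ Metric.ball x (r / 2), Metric.ball y (r / 2) ⊆ Metric.ball x r := by
    intro y hy
    refine Metric.ball_subset_ball' ?_
    have := Metric.mem_ball.1 hy
    linarith
  have hd := differentiableOn_transportTerm hU hstar hΩ
  have hO : IsOpen (Set.univ ×ˢ U : Set (P × V)) := isOpen_univ.prod hU
  have hself := Metric.mem_ball_self (x := x) hr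
  have hself2 := Metric.mem_ball_self (x := x) hr2
  have hs2 : Summable fun m : ℕ => 2 * (‖(1 : 𝔸)‖ * (C ^ m / m.factorial)) / (r / 2) :=
    (hsum.mul_left 2).div_const _
  have hbd : ∀ m, ∀ y ∈ Metric.ball x (r / 2), ‖fderiv ℂ (transportTerm Ω m) y‖
      ≤ 2 * (‖(1 : 𝔸)‖ * (C ^ m / m.factorial)) / (r / 2) := fun m y hy =>
    norm_fderiv_le_of_forall_mem_ball hr2 ((hd m).mono ((hsub y hy).trans hball))
      fun z hz => hb z (hsub y hy hz) m
  have hsx : Summable (fun m => transportTerm Ω m x) :=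
    Summable.of_norm_bounded hsum (hb x hself)
  refine ⟨hsx, Summable.of_norm_bounded hs2 fun m => hbd m x hself2, ?_⟩
  exact hasFDerivAt_tsum_of_isPreconnected hs2 Metric.isOpen_ball
    (convex_ball x (r / 2)).isPreconnected (fun m y hy => ((hd m).differentiableAt
      (hO.mem_nhds (hball (hsub y hy (Metric.mem_ball_self hr2))))).hasFDerivAt) hbd hself2 hsx hself2

theorem differentiableOn_transport [FiniteDimensional ℂ P] [FiniteDimensional ℂ V]
    [CompleteSpace 𝔸] (hU : IsOpen U) (hstar : ∀ v ∈ U, ∀ s ∈ Set.Icc (0 : ℝ) 1, (s : ℂ) • v ∈ U)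
    (hΩ : DifferentiableOn ℂ Ω (Set.univ ×ˢ U)) :
    DifferentiableOn ℂ (transport Ω) (Set.univ ×ˢ U) := fun _ hx =>
  (hasFDerivAt_transport hU hstar hΩ hx).2.2.differentiableAt.differentiableWithinAt

/-- Radial differentiation sends each term to `Ω` times the preceding one and kills the constant
first term. -/
theorem fderiv_transport_radial [FiniteDimensional ℂ P] [FiniteDimensional ℂ V]
    [CompleteSpace 𝔸] (hU : IsOpen U) (hstar : ∀ v ∈ U, ∀ s ∈ Set.Icc (0 : ℝ) 1, (s : ℂ) • v ∈ U)
    (hΩ : DifferentiableOn ℂ Ω (Set.univ ×ˢ U)) {x : P × V} (hx : x ∈ Set.univ ×ˢ U) :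
    fderiv ℂ (transport Ω) x (0, x.2) = Ω x x.2 * transport Ω x := by
  obtain ⟨hs, hs', hd⟩ := hasFDerivAt_transport hU hstar hΩ hx
  have happ : Summable fun m => fderiv ℂ (transportTerm Ω m) x (0, x.2) :=
    (hs'.hasSum.mapL (ContinuousLinearMap.apply ℂ 𝔸 ((0, x.2) : P × V))).summable
  have h1 : (∑' m, fderiv ℂ (transportTerm Ω m) x) (0, x.2)
      = ∑' m, fderiv ℂ (transportTerm Ω m) x (0, x.2) :=
    ((hs'.hasSum.mapL (ContinuousLinearMap.apply ℂ 𝔸 ((0, x.2) : P × V))).tsum_eq).symm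
  rw [hd.fderiv, h1, happ.tsum_eq_zero_add, transport, ← hs.tsum_mul_left]
  have h0 : fderiv ℂ (transportTerm Ω 0) x = 0 := by
    simp only [transportTerm]
    exact (hasFDerivAt_const _ _).fderiv
  simp only [fderiv_transportTerm_succ hU hstar hΩ _ hx, h0]
  simp

/-- The curvature identity which forces the transport of a flat connection to be parallel. -/
theorem fderiv_covariantDeriv_radial [FiniteDimensional ℂ P] [FiniteDimensional ℂ V]
    [CompleteSpace 𝔸] (hU : IsOpen U) (hstar : ∀ v ∈ U, ∀ s ∈ Set.Icc (0 : ℝ) 1, (s : ℂ) • v ∈ U)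
    (hΩ : DifferentiableOn ℂ Ω (Set.univ ×ˢ U))
    (hflat : ∀ x ∈ Set.univ ×ˢ U, ∀ w₁ w₂ : V,
      fderiv ℂ Ω x (0, w₁) w₂ + Ω x w₂ * Ω x w₁ = fderiv ℂ Ω x (0, w₂) w₁ + Ω x w₁ * Ω x w₂)
    {x : P × V} (hx : x ∈ Set.univ ×ˢ U) (w : V) :
    fderiv ℂ (fun y => fderiv ℂ (transport Ω) y (0, w) - Ω y w * transport Ω y) x (0, x.2)
      = -(fderiv ℂ (transport Ω) x (0, w) - Ω x w * transport Ω x)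
        + Ω x x.2 * (fderiv ℂ (transport Ω) x (0, w) - Ω x w * transport Ω x) := by
  have hO : IsOpen (Set.univ ×ˢ U : Set (P × V)) := isOpen_univ.prod hU
  have hH := differentiableOn_transport hU hstar hΩ
  have hnx := hO.mem_nhds hx
  have hHx : HasFDerivAt (transport Ω) (fderiv ℂ (transport Ω) x) x :=
    (hH.differentiableAt hnx).hasFDerivAt
  have hΩx : HasFDerivAt Ω (fderiv ℂ Ω x) x := (hΩ.differentiableAt hnx).hasFDerivAt
  have hH2 : HasFDerivAt (fderiv ℂ (transport Ω)) (fderiv ℂ (fderiv ℂ (transport Ω)) x) x :=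
    ((hH.fderiv_of_isOpen hO).differentiableAt hnx).hasFDerivAt
  have hsymm : fderiv ℂ (fderiv ℂ (transport Ω)) x (0, w) (0, x.2)
      = fderiv ℂ (fderiv ℂ (transport Ω)) x (0, x.2) (0, w) := by
    have h2 : ContDiffAt ℂ (2 : ℕ) (transport Ω) x := (hH.contDiffOn_of_isOpen hO 2).contDiffAt hnx
    exact h2.isSymmSndFDerivAt (by simp [minSmoothness_of_isRCLikeNormedField]) _ _
  have hsnd : HasFDerivAt (fun y : P × V => y.2) (ContinuousLinearMap.snd ℂ P V) x :=
    hasFDerivAt_snd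
  have hpair : HasFDerivAt (fun y : P × V => ((0 : P), y.2))
      (ContinuousLinearMap.prod 0 (ContinuousLinearMap.snd ℂ P V)) x :=
    (hasFDerivAt_const (0 : P) x).prodMk hsnd
  have hE1 := hH2.clm_apply hpair
  have hE2 := (hΩx.clm_apply hsnd).mul' hHx
  -- The radial equation holds near `x`, so it may be differentiated in the direction `(0, w)`;
  -- symmetry of the second derivative then relates this to the radial derivative of the covariant
  -- derivative.
  have heq : (fun y => fderiv ℂ (transport Ω) y (0, y.2))
      =ᶠ[𝓝 x] fun y => Ω y y.2 * transport Ω y :=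
    Filter.eventually_of_mem hnx fun y hy => fderiv_transport_radial hU hstar hΩ hy
  have hE := DFunLike.congr_fun ((hE1.congr_of_eventuallyEq heq.symm).unique hE2) ((0 : P), w)
  have hD := ((hH2.clm_apply (hasFDerivAt_const ((0 : P), w) x)).sub
    ((hΩx.clm_apply (hasFDerivAt_const w x)).mul' hHx)).fderiv
  have hD' := DFunLike.congr_fun hD ((0 : P), x.2)
  refine hD'.trans ?_
  have hrad := fderiv_transport_radial hU hstar hΩ hx
  have hf := hflat x hx w x.2
  simp at hE ⊢
  rw [hsymm] at hE
  rw [hrad]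
  rw [← sub_eq_zero] at hE hf ⊢
  -- The required identity is the differentiated radial equation plus the flatness relation
  -- multiplied by the transport.
  have hf' : (fderiv ℂ Ω x (0, w) x.2 + Ω x x.2 * Ω x w - (fderiv ℂ Ω x (0, x.2) w
    + Ω x w * Ω x x.2)) * transport Ω x = 0 := by rw [hf, zero_mul]
  refine Eq.trans ?_ ((congrArg₂ (· + ·) hE hf').trans (add_zero 0))
  noncomm_ring

/-- **Frobenius' theorem** for a flat holomorphic connection: the transport is parallel. -/
theorem fderiv_transport [FiniteDimensional ℂ P] [FiniteDimensional ℂ V]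
    [CompleteSpace 𝔸] (hU : IsOpen U) (hstar : ∀ v ∈ U, ∀ s ∈ Set.Icc (0 : ℝ) 1, (s : ℂ) • v ∈ U)
    (hΩ : DifferentiableOn ℂ Ω (Set.univ ×ˢ U))
    (hflat : ∀ x ∈ Set.univ ×ˢ U, ∀ w₁ w₂ : V,
      fderiv ℂ Ω x (0, w₁) w₂ + Ω x w₂ * Ω x w₁ = fderiv ℂ Ω x (0, w₂) w₁ + Ω x w₁ * Ω x w₂)
    {x : P × V} (hx : x ∈ Set.univ ×ˢ U) (w : V) :
    fderiv ℂ (transport Ω) x (0, w) = Ω x w * transport Ω x := by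
  have hO : IsOpen (Set.univ ×ˢ U : Set (P × V)) := isOpen_univ.prod hU
  have hH := differentiableOn_transport hU hstar hΩ
  set E : P × V → 𝔸 := fun y => fderiv ℂ (transport Ω) y (0, w) - Ω y w * transport Ω y with hE
  have hEd : DifferentiableOn ℂ E (Set.univ ×ˢ U) :=
    ((hH.fderiv_of_isOpen hO).clm_apply (differentiableOn_const _)).sub
      ((hΩ.clm_apply (differentiableOn_const _)).mul hH)
  let c : ℝ → P × V := fun t => (x.1, (t : ℂ) • x.2)
  have hcS : ∀ t ∈ Set.Icc (0 : ℝ) 1, c t ∈ Set.univ ×ˢ U := fun t ht =>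
    ⟨trivial, hstar _ hx.2 t ht⟩
  have hcd : ∀ t, HasDerivAt c (0, x.2) t := fun t => by
    refine (hasDerivAt_const _ _).prodMk ?_
    simpa using (Complex.ofRealCLM.hasDerivAt (x := t)).smul_const x.2
  have hcc : Continuous c := by fun_prop
  -- The factor `t` absorbs the term `-E` of the curvature identity, leaving a homogeneous linear
  -- equation. It also makes the initial value zero without knowing `E` at the origin.
  have := eq_zero_of_hasDerivAt_mul_of_left (a := fun t => Ω (c t) x.2)
    (f := fun t => (t : ℂ) • E (c t)) ?_ (fun t ht => ?_) (by simp) 1 (by simp)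
  · have hc1 : c 1 = x := by simp [c]
    rw [Complex.ofReal_one, one_smul, hc1] at this
    exact sub_eq_zero.1 this
  · exact (hΩ.continuousOn.comp hcc.continuousOn hcS).clm_apply continuousOn_const
  · have hEt : HasFDerivAt E (fderiv ℂ E (c t)) (c t) :=
      (hEd.differentiableAt (hO.mem_nhds (hcS t ht))).hasFDerivAt
    have h1 := (Complex.ofRealCLM.hasDerivAt (x := t)).smul
      ((hEt.restrictScalars ℝ).comp_hasDerivAt t (hcd t))
    have h2 := fderiv_covariantDeriv_radial hU hstar hΩ hflat (hcS t ht) w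
    have h3 : ((0 : P), (c t).2) = (t : ℂ) • ((0 : P), x.2) := by simp [c]
    rw [h3, map_smul] at h2
    change (t : ℂ) • fderiv ℂ E (c t) (0, x.2) = -(E (c t)) + Ω (c t) ((t : ℂ) • x.2) * E (c t)
      at h2
    refine h1.congr_deriv ?_
    simp only [ContinuousLinearMap.coe_restrictScalars', Complex.ofRealCLM_apply,
      Complex.ofReal_one, one_smul, Function.comp]
    rw [h2, map_smul]
    simp

/-- The parallel transport is not a left zero divisor. -/
theorem transport_mul_left_cancel [FiniteDimensional ℂ P] [FiniteDimensional ℂ V]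
    [CompleteSpace 𝔸] (hU : IsOpen U) (hstar : ∀ v ∈ U, ∀ s ∈ Set.Icc (0 : ℝ) 1, (s : ℂ) • v ∈ U)
    (hΩ : DifferentiableOn ℂ Ω (Set.univ ×ˢ U))
    (hpar : ∀ x ∈ Set.univ ×ˢ U, ∀ w, fderiv ℂ (transport Ω) x (0, w) = Ω x w * transport Ω x)
    {x : P × V} (hx : x ∈ Set.univ ×ˢ U) {X : 𝔸} (hX : transport Ω x * X = 0) : X = 0 := by
  have hO : IsOpen (Set.univ ×ˢ U : Set (P × V)) := isOpen_univ.prod hU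
  have hH := differentiableOn_transport hU hstar hΩ
  let c : ℝ → P × V := fun t => (x.1, (t : ℂ) • x.2)
  have hcS : ∀ t ∈ Set.Icc (0 : ℝ) 1, c t ∈ Set.univ ×ˢ U := fun t ht =>
    ⟨trivial, hstar _ hx.2 t ht⟩
  have hcd : ∀ t, HasDerivAt c (0, x.2) t := fun t => by
    refine (hasDerivAt_const _ _).prodMk ?_
    simpa using (Complex.ofRealCLM.hasDerivAt (x := t)).smul_const x.2
  have hcc : Continuous c := by fun_prop
  -- The product with `X` solves a linear equation along the segment and vanishes at its end, hence
  -- also at its start, where the transport is `1`.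
  have := eq_zero_of_hasDerivAt_mul_of_right (a := fun t => Ω (c t) x.2)
    (f := fun t => transport Ω (c t) * X) ?_ (fun t ht => ?_) (by simpa [c] using hX)
  · simpa [c, transport_zero] using this
  · exact (hΩ.continuousOn.comp hcc.continuousOn hcS).clm_apply continuousOn_const
  · have hHt : HasFDerivAt (transport Ω) (fderiv ℂ (transport Ω) (c t)) (c t) :=
      (hH.differentiableAt (hO.mem_nhds (hcS t ht))).hasFDerivAt
    have h1 := ((hHt.restrictScalars ℝ).comp_hasDerivAt t (hcd t)).mul_const X
    refine h1.congr_deriv ?_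
    simp only [ContinuousLinearMap.coe_restrictScalars']
    rw [hpar _ (hcS t ht), mul_assoc]

/-- Two parallel sections which agree at the origin are equal. -/
theorem eq_zero_of_parallel {S : V → 𝔸} {ω : V → V →L[ℂ] 𝔸} (hU : IsOpen U)
    (hstar : ∀ v ∈ U, ∀ s ∈ Set.Icc (0 : ℝ) 1, (s : ℂ) • v ∈ U)
    (hω : ContinuousOn ω U) (hS : DifferentiableOn ℂ S U)
    (hpar : ∀ v ∈ U, ∀ w, fderiv ℂ S v w = ω v w * S v) (h0 : S 0 = 0) :
    ∀ v ∈ U, S v = 0 := by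
  intro v hv
  let c : ℝ → V := fun t => (t : ℂ) • v
  have hcS : ∀ t ∈ Set.Icc (0 : ℝ) 1, c t ∈ U := fun t ht => hstar _ hv t ht
  have hcd : ∀ t, HasDerivAt c v t := fun t => by
    exact ((Complex.ofRealCLM.hasDerivAt (x := t)).smul_const v).congr_deriv (by simp)
  have hcc : Continuous c := by fun_prop
  have := eq_zero_of_hasDerivAt_mul_of_left (a := fun t => ω (c t) v)
    (f := fun t => S (c t)) ?_ (fun t ht => ?_) (by simpa [c] using h0) 1 (by simp)
  · simpa [c] using this
  · exact (hω.comp hcc.continuousOn hcS).clm_apply continuousOn_const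
  · have hHt : HasFDerivAt S (fderiv ℂ S (c t)) (c t) :=
      (hS.differentiableAt (hU.mem_nhds (hcS t ht))).hasFDerivAt
    refine ((hHt.restrictScalars ℝ).comp_hasDerivAt t (hcd t)).congr_deriv ?_
    simp only [ContinuousLinearMap.coe_restrictScalars']
    rw [hpar _ (hcS t ht)]

end ParallelTransport

/-! ### Jordan normal form with sorted eigenvalues -/

section JordanForm

open Polynomial Module

/-- A linear relation lifts to a polynomial of degree `< e` divisible by `(X - a)^e`, hence zero;
the substitution `X ↦ X + a` then isolates the coefficients. -/
theorem linearIndependent_mkQ_X_sub_C_pow (a : ℂ) (e : ℕ) :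
    LinearIndependent ℂ fun s : Fin e =>
      (Submodule.span ℂ[X] {(X - C a) ^ e}).mkQ ((X - C a) ^ (e - 1 - (s : ℕ))) := by
  rw [Fintype.linearIndependent_iff]
  intro g hg
  have hsum : (Submodule.span ℂ[X] {(X - C a) ^ e}).mkQ
      (∑ s : Fin e, g s • (X - C a) ^ (e - 1 - (s : ℕ))) = 0 := by
    rw [← hg, map_sum]
    refine Finset.sum_congr rfl fun s _ => ?_
    exact LinearMap.map_smul_of_tower _ _ _
  rw [Submodule.mkQ_apply, Submodule.Quotient.mk_eq_zero] at hsum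
  have hdvd : (X - C a) ^ e ∣ ∑ s : Fin e, g s • (X - C a) ^ (e - 1 - (s : ℕ)) :=
    Ideal.mem_span_singleton.1 hsum
  have hzero : ∑ s : Fin e, g s • (X - C a) ^ (e - 1 - (s : ℕ)) = 0 := by
    refine eq_zero_of_dvd_of_degree_lt hdvd ?_
    rw [degree_pow, degree_X_sub_C, nsmul_one]
    refine mem_degreeLT.1 (Submodule.sum_mem _ fun s _ => mem_degreeLT.2 ?_)
    refine (degree_smul_le _ _).trans_lt ?_
    rw [degree_pow, degree_X_sub_C, nsmul_one]
    have := s.2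
    exact_mod_cast (by omega : e - 1 - (s : ℕ) < e)
  have hcomp := congrArg (fun q : ℂ[X] => q.comp (X + C a)) hzero
  simp only [zero_comp, sum_comp, smul_comp, pow_comp, sub_comp, X_comp, C_comp,
    add_sub_cancel_right] at hcomp
  intro s
  have hcoeff := congrArg (fun q : ℂ[X] => q.coeff (e - 1 - (s : ℕ))) hcomp
  simp only [finsetSum_coeff, coeff_smul, coeff_X_pow, coeff_zero] at hcoeff
  rw [Finset.sum_eq_single s] at hcoeff
  · simpa using hcoeff
  · intro t _ hts
    have h1 := s.2
    have h2 := t.2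
    have : ¬ (e - 1 - (s : ℕ) = e - 1 - (t : ℕ)) := fun h => hts (Fin.ext (by omega))
    simp [this]
  · simp

/-- The powers of `X - a` are listed in decreasing order, so that multiplication by `X - a` moves
each basis vector to the preceding one: the ones of the Jordan block land above the diagonal. The
first vector goes to `(X - a)^e = 0`. -/
theorem exists_basis_quotient_X_sub_C_pow (a : ℂ) (e : ℕ) :
    ∃ b : Basis (Fin e) ℂ (ℂ[X] ⧸ Submodule.span ℂ[X] {(X - C a) ^ e}),
      ∀ s : Fin e, (X : ℂ[X]) • b s
        = a • b s + if 0 < (s : ℕ) then b ⟨s - 1, by omega⟩ else 0 := by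
  have hcard : Fintype.card (Fin e)
      = finrank ℂ (ℂ[X] ⧸ Submodule.span ℂ[X] {(X - C a) ^ e}) := by
    have := finrank_quotient_span_eq_natDegree (f := (X - C a) ^ e)
    rw [natDegree_pow, natDegree_X_sub_C, mul_one] at this
    rw [Fintype.card_fin]
    exact this.symm
  have : Module.Finite ℂ (ℂ[X] ⧸ Submodule.span ℂ[X] {(X - C a) ^ e}) :=
    (monic_X_sub_C a).pow e |>.finite_quotient
  have hli := linearIndependent_mkQ_X_sub_C_pow a e
  refine ⟨Basis.mk hli (hli.span_eq_top_of_card_eq_finrank' hcard).ge, fun s => ?_⟩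
  simp only [Basis.mk_apply]
  have key : ∀ k : ℕ, (X : ℂ[X]) • (Submodule.span ℂ[X] {(X - C a) ^ e}).mkQ ((X - C a) ^ k)
      = a • (Submodule.span ℂ[X] {(X - C a) ^ e}).mkQ ((X - C a) ^ k)
        + (Submodule.span ℂ[X] {(X - C a) ^ e}).mkQ ((X - C a) ^ (k + 1)) := by
    intro k
    rw [← map_smul, ← LinearMap.map_smul_of_tower, ← map_add]
    congr 1
    rw [smul_eq_mul, smul_eq_C_mul]
    ring
  rw [key]
  congr 1
  have h := s.2
  split_ifs with hs
  · congr 2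
    omega
  · have : e - 1 - (s : ℕ) + 1 = e := by omega
    rw [this, Submodule.mkQ_apply, Submodule.Quotient.mk_eq_zero]
    exact Submodule.mem_span_singleton_self _

theorem exists_basis_quotient_irreducible_pow {p : ℂ[X]} (hp : Irreducible p) (e : ℕ) :
    ∃ (a : ℂ) (b : Basis (Fin e) ℂ (ℂ[X] ⧸ Submodule.span ℂ[X] {p ^ e})),
      ∀ s : Fin e, (X : ℂ[X]) • b s
        = a • b s + if 0 < (s : ℕ) then b ⟨s - 1, by omega⟩ else 0 := by
  obtain ⟨a, ha⟩ := IsAlgClosed.exists_root p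
    (by rw [IsAlgClosed.degree_eq_one_of_irreducible ℂ hp]; simp)
  have hassoc : Associated (X - C a) p :=
    (irreducible_X_sub_C a).associated_of_dvd hp (dvd_iff_isRoot.2 ha)
  have hspan : Submodule.span ℂ[X] {p ^ e} = Submodule.span ℂ[X] {(X - C a) ^ e} :=
    (Ideal.span_singleton_eq_span_singleton.2 (hassoc.pow_pow (n := e))).symm
  rw [hspan]
  exact ⟨a, exists_basis_quotient_X_sub_C_pow a e⟩

theorem DFinsupp.basis_apply_eq_single {ι R : Type*} [DecidableEq ι] [Semiring R] {M : ι → Type*}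
    [∀ i, AddCommMonoid (M i)] [∀ i, Module R (M i)] {η : ι → Type*}
    (b : ∀ i, Basis (η i) R (M i)) (i : ι) (s : η i) :
    DFinsupp.basis b ⟨i, s⟩ = DFinsupp.single i (b i s) := by
  classical
  apply (DFinsupp.basis b).repr.injective
  rw [Basis.repr_self]
  ext ⟨j, t⟩
  simp only [DFinsupp.basis, LinearEquiv.trans_apply]
  rw [sigmaFinsuppLequivDFinsupp_symm_apply]
  simp only [DFinsupp.mapRange.linearEquiv_apply]
  by_cases hij : i = j
  · subst hij
    simp [Finsupp.single_apply]
  · simp [hij, DFinsupp.single_apply]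

/-- Every endomorphism of a finite-dimensional complex vector space has a Jordan basis. -/
theorem exists_jordan_basis {W : Type} [AddCommGroup W] [Module ℂ W] [FiniteDimensional ℂ W]
    (f : End ℂ W) :
    ∃ (ι : Type) (_ : Fintype ι) (e : ι → ℕ) (μ : ι → ℂ) (B : Basis (Σ i, Fin (e i)) ℂ W),
      ∀ (i : ι) (s : Fin (e i)), f (B ⟨i, s⟩)
        = μ i • B ⟨i, s⟩ + if 0 < (s : ℕ) then B ⟨i, ⟨s - 1, by omega⟩⟩ else 0 := by
  classical
  -- The space, with `X` acting as `f`, is a finitely generated torsion module over the principal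
  -- ideal domain `ℂ[X]`.
  obtain ⟨ι, hι, p, hp, e, ⟨φ⟩⟩ := Module.equiv_directSum_of_isTorsion
    (AEval.isTorsion_of_finiteDimensional ℂ W f)
  choose μ b hb using fun i => exists_basis_quotient_irreducible_pow (hp i) (e i)
  let ψ : W ≃ₗ[ℂ] DirectSum ι fun i => ℂ[X] ⧸ Submodule.span ℂ[X] {p i ^ e i} :=
    (AEval'.of f).trans (φ.restrictScalars ℂ)
  have hψ : ∀ w, ψ (f w) = (X : ℂ[X]) • ψ w := fun w => by
    simp only [ψ, LinearEquiv.trans_apply, LinearEquiv.restrictScalars_apply]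
    rw [← map_smul]
    congr 1
    exact (AEval'.X_smul_of f w).symm
  let B₀ : Basis (Σ i, Fin (e i)) ℂ (DirectSum ι fun i => ℂ[X] ⧸ Submodule.span ℂ[X] {p i ^ e i}) :=
    DFinsupp.basis b
  have hB₀ : ∀ i s, B₀ ⟨i, s⟩ = DFinsupp.single i (b i s) :=
    DFinsupp.basis_apply_eq_single b
  refine ⟨ι, hι, e, μ, B₀.map ψ.symm, fun i s => ψ.injective ?_⟩
  rw [hψ, map_add, map_smul]
  simp only [Basis.map_apply, LinearEquiv.apply_symm_apply]
  have hX : (X : ℂ[X]) • B₀ ⟨i, s⟩ = DFinsupp.single i ((X : ℂ[X]) • b i s) := by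
    rw [hB₀]
    exact (DFinsupp.single_smul _ _).symm
  rw [hX, hb]
  split_ifs with hs
  · rw [LinearEquiv.apply_symm_apply, hB₀, hB₀, DFinsupp.single_add, DFinsupp.single_smul]
  · rw [map_zero, hB₀, add_zero, add_zero, DFinsupp.single_smul]

/-- The flattening is lexicographic: a position is the total length of the earlier blocks plus the
offset. This carries sortedness of the blocks over to the diagonal of the Jordan matrix. -/
theorem fst_le_of_finSigmaFinEquiv_le {m : ℕ} {e : Fin m → ℕ} {x y : Σ i, Fin (e i)}
    (h : (finSigmaFinEquiv x : ℕ) ≤ finSigmaFinEquiv y) : x.1 ≤ y.1 := by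
  by_contra! hlt
  let g : ℕ → ℕ := fun k => if hk : k < m then e ⟨k, hk⟩ else 0
  have hsum : ∀ z : Σ i, Fin (e i),
      (finSigmaFinEquiv z : ℕ) = ∑ k ∈ Finset.range z.1, g k + z.2 := by
    intro z
    rw [finSigmaFinEquiv_apply, ← Fin.sum_univ_eq_sum_range]
    congr 1
    refine Finset.sum_congr rfl fun k _ => ?_
    have hk : (k : ℕ) < m := k.2.trans z.1.2
    simp only [g, hk, dif_pos]
    rfl
  rw [hsum, hsum] at h
  have hy : g y.1 = e y.1 := by simp [g]
  have hle : ∑ k ∈ Finset.range (y.1 + 1), g k ≤ ∑ k ∈ Finset.range x.1, g k :=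
    Finset.sum_le_sum_of_subset (Finset.range_mono hlt)
  rw [Finset.sum_range_succ, hy] at hle
  have := y.2.2
  omega

/-- **Jordan normal form**, with the Jordan blocks sorted by a key of the eigenvalue. -/
theorem exists_isJordanMatrix {n : ℕ} (A : Matrix (Fin n) (Fin n) ℂ) {α : Type*} [LinearOrder α]
    (key : ℂ → α) :
    ∃ G J : Matrix (Fin n) (Fin n) ℂ, IsUnit G ∧ A * G = G * J ∧ IsJordanMatrix J ∧
      Monotone fun i => key (J i i) := by
  obtain ⟨ι, hι, e₀, μ₀, B, hB⟩ := exists_jordan_basis (Matrix.toLin' A)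
  let m := Fintype.card ι
  let τ₀ : Fin m ≃ ι := (Fintype.equivFin ι).symm
  let τ : Fin m ≃ ι := (Tuple.sort fun i => key (μ₀ (τ₀ i))).trans τ₀
  have hmono : Monotone fun i => key (μ₀ (τ i)) := Tuple.monotone_sort fun i => key (μ₀ (τ₀ i))
  let e : Fin m → ℕ := fun i => e₀ (τ i)
  let T : (Σ i, Fin (e i)) ≃ Σ i, Fin (e₀ i) := Equiv.sigmaCongrLeft (β := fun i => Fin (e₀ i)) τ
  have hn : ∑ i, e i = n := by
    have h1 := Module.finrank_eq_card_basis B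
    rw [Module.finrank_fin_fun, ← Fintype.card_congr T] at h1
    simpa using h1.symm
  let ε : (Σ i, Fin (e i)) ≃ Fin n := finSigmaFinEquiv.trans (finCongr hn)
  have hε : ∀ x, (ε x : ℕ) = finSigmaFinEquiv x := fun x => rfl
  have hpred : ∀ (i : Fin m) (s : Fin (e i)) (hs : 0 < (s : ℕ)),
      (ε ⟨i, s⟩ : ℕ) = ε ⟨i, ⟨s - 1, by omega⟩⟩ + 1 := by
    intro i s hs
    rw [hε, hε, finSigmaFinEquiv_apply, finSigmaFinEquiv_apply]
    dsimp only
    omega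
  let b : Basis (Fin n) ℂ (Fin n → ℂ) := B.reindex (T.symm.trans ε)
  have hb : ∀ i s, b (ε ⟨i, s⟩) = B ⟨τ i, s⟩ := fun i s => by
    simp only [b, Basis.reindex_apply, Equiv.symm_trans_apply, Equiv.symm_symm,
      Equiv.symm_apply_apply]
    rfl
  have hAb : ∀ (i : Fin m) (s : Fin (e i)), Matrix.toLin' A (b (ε ⟨i, s⟩))
      = μ₀ (τ i) • b (ε ⟨i, s⟩)
        + if 0 < (s : ℕ) then b (ε ⟨i, ⟨s - 1, by omega⟩⟩) else 0 := fun i s => by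
    rw [hb, hB]
    congr 1
    split_ifs
    · rw [hb]
    · rfl
  let J := LinearMap.toMatrix b b (Matrix.toLin' A)
  have hJ : ∀ (k : Fin n) (i : Fin m) (s : Fin (e i)), J k (ε ⟨i, s⟩)
      = (if ε ⟨i, s⟩ = k then μ₀ (τ i) else 0)
        + if 0 < (s : ℕ) ∧ (ε ⟨i, s⟩ : ℕ) = k + 1 then 1 else 0 := by
    intro k i s
    simp only [J, LinearMap.toMatrix_apply, hAb, map_add, map_smul, Finsupp.add_apply,
      Finsupp.smul_apply, Basis.repr_self, Finsupp.single_apply, smul_eq_mul, mul_ite, mul_one,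
      mul_zero]
    congr 1
    by_cases hs : 0 < (s : ℕ)
    · have h1 := hpred i s hs
      simp only [hs, if_true, true_and, Basis.repr_self, Finsupp.single_apply]
      refine if_congr ?_ rfl rfl
      rw [Fin.ext_iff]
      omega
    · simp [hs]
  have hdiag : ∀ x, J (ε x) (ε x) = μ₀ (τ x.1) := fun x => by
    have h1 : ¬ (ε x : ℕ) = ε x + 1 := by omega
    have := hJ (ε x) x.1 x.2
    rw [this]
    simp
  let std := Pi.basisFun ℂ (Fin n)
  have hstd : LinearMap.toMatrix std std (Matrix.toLin' A) = A := by
    rw [LinearMap.toMatrix_eq_toMatrix', LinearMap.toMatrix'_toLin']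
  have hconj := basis_toMatrix_mul_linearMap_toMatrix_mul_basis_toMatrix std b std b
    (Matrix.toLin' A)
  have hinv : b.toMatrix std * std.toMatrix b = 1 := Basis.toMatrix_mul_toMatrix_flip b std
  refine ⟨std.toMatrix b, J, IsUnit.of_mul_eq_one_right _ hinv, ?_, ?_, ?_⟩
  · rw [hstd] at hconj
    conv_lhs => rw [← hconj]
    rw [mul_assoc, hinv, mul_one]
  · constructor
    · intro k j hjk hjk'
      obtain ⟨⟨i, s⟩, rfl⟩ := ε.surjective j
      rw [hJ, if_neg hjk, if_neg (fun h => hjk' h.2), add_zero]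
    · intro k j hjk
      obtain ⟨⟨i, s⟩, rfl⟩ := ε.surjective j
      have hne : ε ⟨i, s⟩ ≠ k := fun h => by rw [h] at hjk; omega
      rw [hJ, if_neg hne, zero_add]
      by_cases hs : 0 < (s : ℕ)
      · refine Or.inr ⟨by simp [hs, hjk], ?_⟩
        have h1 := hpred i s hs
        have hk : k = ε ⟨i, ⟨s - 1, by omega⟩⟩ := Fin.ext (by omega)
        rw [hk, hdiag, hdiag]
      · exact Or.inl (by simp [hs])
  · intro k j hkj
    obtain ⟨x, rfl⟩ := ε.surjective k
    obtain ⟨y, rfl⟩ := ε.surjective j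
    dsimp only
    rw [hdiag, hdiag]
    exact hmono (fst_le_of_finSigmaFinEquiv_le (by rw [← hε, ← hε]; exact hkj))

end JordanForm

/-! ### The formal Levelt normal form of a Fuchsian singularity -/

section FormalLevelt

/-- Projection onto the entries which are not in resonance for the shift `k`. -/
noncomputable def nonresonantPart {n : ℕ} (J : Matrix (Fin n) (Fin n) ℂ) (k : ℂ) :
    Matrix (Fin n) (Fin n) ℂ →ₗ[ℂ] Matrix (Fin n) (Fin n) ℂ where
  toFun M := Matrix.of fun i j => if J i i - J j j = k then 0 else M i j
  map_add' M N := by ext i j; simp only [Matrix.of_apply, Matrix.add_apply]; split_ifs <;> simp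
  map_smul' c M := by
    ext i j; simp only [Matrix.of_apply, Matrix.smul_apply, RingHom.id_apply]; split_ifs <;> simp

/-- The operator `X ↦ kX + XJ - JX` is triangular in a suitable order of the entries, with diagonal
coefficients `k - (J_ii - J_jj)`. It is inverted on the entries where these are nonzero; the
remaining, resonant, entries are absorbed in `R`. The map `Φ` combines both unknowns. -/
theorem exists_resonant_solution {n : ℕ} (J C : Matrix (Fin n) (Fin n) ℂ)
    (hJ : ∀ i j : Fin n, j ≠ i → (j : ℕ) ≠ i + 1 → J i j = 0) (k : ℂ) :
    ∃ X R : Matrix (Fin n) (Fin n) ℂ, k • X + X * J + R = J * X + C ∧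
      ∀ i j, R i j ≠ 0 → J i i - J j j = k := by
  let π := nonresonantPart J k
  have hπ : ∀ M i j, π M i j = if J i i - J j j = k then 0 else M i j := fun M i j => rfl
  let Φ : Matrix (Fin n) (Fin n) ℂ →ₗ[ℂ] Matrix (Fin n) (Fin n) ℂ :=
    k • π + (LinearMap.mulRight ℂ J) ∘ₗ π - (LinearMap.mulLeft ℂ J) ∘ₗ π + (LinearMap.id - π)
  have hΦ : ∀ M, Φ M = k • π M + π M * J - J * π M + (M - π M) := fun M => rfl
  have hinj : Function.Injective Φ := by
    rw [injective_iff_map_eq_zero]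
    intro M hM
    -- The induction runs away from the lower left corner: `J` being upper bidiagonal, the equation
    -- at `(i, j)` involves besides `M i j` only the entries at `(i, j-1)` and `(i+1, j)`, which
    -- come earlier.
    have hind : ∀ N : ℕ, ∀ i j : Fin n, (j : ℕ) + (n - i) ≤ N → M i j = 0 := by
      intro N
      induction N with
      | zero => intro i j hij; omega
      | succ N ih =>
        intro i j hij
        have hπ0 : ∀ i' j' : Fin n, (j' : ℕ) + (n - i') ≤ N → π M i' j' = 0 := by
          intro i' j' h
          rw [hπ, ih i' j' h, ite_self]
        have h1 : (π M * J) i j = π M i j * J j j := by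
          rw [Matrix.mul_apply, Finset.sum_eq_single j]
          · intro j' _ hj'
            by_cases h : (j : ℕ) = j' + 1
            · rw [hπ0 i j' (by omega), zero_mul]
            · rw [hJ j' j hj'.symm h, mul_zero]
          · simp
        have h2 : (J * π M) i j = J i i * π M i j := by
          rw [Matrix.mul_apply, Finset.sum_eq_single i]
          · intro i' _ hi'
            by_cases h : (i' : ℕ) = i + 1
            · rw [hπ0 i' j (by omega), mul_zero]
            · rw [hJ i i' hi' h, zero_mul]
          · simp
        have h3 := congrFun (congrFun hM i) j
        rw [hΦ] at h3
        simp only [Matrix.add_apply, Matrix.sub_apply, Matrix.smul_apply, smul_eq_mul, h1, h2,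
          Matrix.zero_apply, hπ] at h3
        split_ifs at h3 with hres
        · simpa using h3
        · have h4 : (k - (J i i - J j j)) * M i j = 0 := by linear_combination h3
          rcases mul_eq_zero.1 h4 with h | h
          · exact absurd (sub_eq_zero.1 h).symm hres
          · exact h
    ext i j
    exact hind _ i j le_rfl
  obtain ⟨M, hM⟩ := LinearMap.injective_iff_surjective.1 hinj C
  refine ⟨π M, M - π M, ?_, fun i j hij => ?_⟩
  · rw [← hM, hΦ]
    abel
  · by_contra hres
    exact hij (by rw [Matrix.sub_apply, hπ, if_neg hres, sub_self])

/-- Course-of-values recursion: `hist k` already carries the correct values up to index `k`, and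
`hstep` says that no others are read. -/
theorem exists_seq_of_history {α : Type*} (a : α) (step : ℕ → (ℕ → α) → α)
    (hstep : ∀ k f g, (∀ m ≤ k, f m = g m) → step k f = step k g) :
    ∃ s : ℕ → α, s 0 = a ∧ ∀ k, s (k + 1) = step k s := by
  let hist : ℕ → ℕ → α := fun k =>
    Nat.rec (fun _ => a) (fun k h => Function.update h (k + 1) (step k h)) k
  have hsucc : ∀ k, hist (k + 1) = Function.update (hist k) (k + 1) (step k (hist k)) :=
    fun k => rfl
  have hstable : ∀ k m, m ≤ k → hist k m = hist m m := by
    intro k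
    induction k with
    | zero => intro m hm; rw [Nat.le_zero.1 hm]
    | succ k ih =>
      intro m hm
      rcases hm.lt_or_eq with h | h
      · rw [hsucc, Function.update_of_ne h.ne, ih m (Nat.lt_succ_iff.1 h)]
      · rw [h]
  refine ⟨fun k => hist k k, rfl, fun k => ?_⟩
  dsimp only
  rw [hsucc, Function.update_self]
  exact hstep k _ _ fun m hm => hstable k m hm

/-- The formal gauge transformation `∑ P_k z^k` which reduces `z Y' = (J + z B) Y` to a system
whose coefficient `∑ R_k z^k` has only resonant entries. -/
theorem exists_formal_levelt {n : ℕ} (J B : Matrix (Fin n) (Fin n) ℂ)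
    (hJ : ∀ i j : Fin n, j ≠ i → (j : ℕ) ≠ i + 1 → J i j = 0) :
    ∃ P R : ℕ → Matrix (Fin n) (Fin n) ℂ, P 0 = 1 ∧ R 0 = J ∧
      (∀ k i j, R (k + 1) i j ≠ 0 → J i i - J j j = ((k + 1 : ℕ) : ℂ)) ∧
      ∀ k, ((k + 1 : ℕ) : ℂ) • P (k + 1) + ∑ p ∈ Finset.HasAntidiagonal.antidiagonal (k + 1), P p.1 * R p.2
        = J * P (k + 1) + B * P k := by
  choose X R hXR hres using fun (k : ℂ) (C : Matrix (Fin n) (Fin n) ℂ) =>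
    exists_resonant_solution J C hJ k
  -- Since `P 0 = 1` and `R 0 = J`, the two end terms of the convolution are the unknown `R (k+1)`
  -- and `P (k+1) * J`; everything already known is collected here.
  let rhs : ℕ → (ℕ → Matrix (Fin n) (Fin n) ℂ × Matrix (Fin n) (Fin n) ℂ) →
      Matrix (Fin n) (Fin n) ℂ := fun k f =>
    B * (f k).1 - ∑ m ∈ Finset.range k, (f (m + 1)).1 * (f (k - m)).2
  obtain ⟨s, hs0, hs⟩ := exists_seq_of_history ((1, J) : Matrix (Fin n) (Fin n) ℂ × _)
    (fun k f => (X ((k + 1 : ℕ) : ℂ) (rhs k f), R ((k + 1 : ℕ) : ℂ) (rhs k f))) (by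
      intro k f g hfg
      have : rhs k f = rhs k g := by
        simp only [rhs]
        rw [hfg k le_rfl]
        congr 1
        refine Finset.sum_congr rfl fun m hm => ?_
        have := Finset.mem_range.1 hm
        rw [hfg (m + 1) (by omega), hfg (k - m) (by omega)]
      rw [this])
  refine ⟨fun k => (s k).1, fun k => (s k).2, congrArg Prod.fst hs0,
    congrArg Prod.snd hs0, fun k i j h => ?_,
    fun k => ?_⟩
  · simp only [hs] at h
    exact hres _ _ i j h
  · have h1 := hXR ((k + 1 : ℕ) : ℂ) (rhs k s)
    have h2 : X ((k + 1 : ℕ) : ℂ) (rhs k s) = (s (k + 1)).1 := by rw [hs]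
    have h3 : R ((k + 1 : ℕ) : ℂ) (rhs k s) = (s (k + 1)).2 := by rw [hs]
    rw [h2, h3] at h1
    rw [Finset.Nat.sum_antidiagonal_eq_sum_range_succ_mk, Finset.sum_range_succ,
      Finset.sum_range_succ']
    simp only [Nat.sub_self, Nat.sub_zero, hs0, one_mul]
    have h4 : ∑ m ∈ Finset.range k, (s (m + 1)).1 * (s (k + 1 - (m + 1))).2
        = ∑ m ∈ Finset.range k, (s (m + 1)).1 * (s (k - m)).2 :=
      Finset.sum_congr rfl fun m _ => by rw [Nat.add_sub_add_right]
    rw [h4]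
    simp only [rhs] at h1
    rw [← sub_eq_zero] at h1 ⊢
    rw [← h1]
    abel

end FormalLevelt

/-! ### Convergence of the formal gauge transformation -/

section Convergence

variable {𝔸 : Type*} [NormedRing 𝔸] [NormedAlgebra ℂ 𝔸] {J B : 𝔸} {P R : ℕ → 𝔸}

/-- For the weighted norms `a k = ‖P k‖ ρ^k`, the recursion carries a factor `k + 1` on the left and
bounded weights on the right. Beyond the total weight `S` no term can exceed all earlier ones. As
`ρ` is arbitrary, the series will be entire. -/
theorem exists_bound_of_formal_levelt (hR : ∀ ρ : ℝ, 0 ≤ ρ → Summable fun k => ‖R k‖ * ρ ^ k)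
    (hP : ∀ k, ((k + 1 : ℕ) : ℂ) • P (k + 1) + ∑ p ∈ Finset.HasAntidiagonal.antidiagonal (k + 1), P p.1 * R p.2
      = J * P (k + 1) + B * P k) {ρ : ℝ} (hρ : 0 ≤ ρ) :
    ∃ M, 0 ≤ M ∧ ∀ k, ‖P k‖ * ρ ^ k ≤ M := by
  set a : ℕ → ℝ := fun k => ‖P k‖ * ρ ^ k with ha
  set r : ℕ → ℝ := fun k => ‖R k‖ * ρ ^ k with hr
  have ha0 : ∀ k, 0 ≤ a k := fun k => by positivity
  have hr0 : ∀ k, 0 ≤ r k := fun k => by positivity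
  set S : ℝ := ‖J‖ + ρ * ‖B‖ + ∑' k, r k with hS
  have hrec : ∀ k : ℕ, (k + 1 : ℝ) * a (k + 1) ≤ ‖J‖ * a (k + 1) + ρ * ‖B‖ * a k
      + ∑ p ∈ Finset.HasAntidiagonal.antidiagonal (k + 1), a p.1 * r p.2 := by
    intro k
    have h1 : ((k + 1 : ℕ) : ℂ) • P (k + 1)
        = J * P (k + 1) + B * P k - ∑ p ∈ Finset.HasAntidiagonal.antidiagonal (k + 1), P p.1 * R p.2 :=
      eq_sub_of_add_eq (hP k)
    have h2 : (k + 1 : ℝ) * ‖P (k + 1)‖ ≤ ‖J‖ * ‖P (k + 1)‖ + ‖B‖ * ‖P k‖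
        + ∑ p ∈ Finset.HasAntidiagonal.antidiagonal (k + 1), ‖P p.1‖ * ‖R p.2‖ := by
      have h3 : (k + 1 : ℝ) * ‖P (k + 1)‖ = ‖((k + 1 : ℕ) : ℂ) • P (k + 1)‖ := by
        rw [norm_smul, Complex.norm_natCast]
        push_cast
        rfl
      rw [h3, h1]
      refine (norm_sub_le _ _).trans (add_le_add ((norm_add_le _ _).trans
        (add_le_add (norm_mul_le _ _) (norm_mul_le _ _))) ?_)
      exact (norm_sum_le _ _).trans (Finset.sum_le_sum fun p _ => norm_mul_le _ _)
    have h4 : ∑ p ∈ Finset.HasAntidiagonal.antidiagonal (k + 1), a p.1 * r p.2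
        = (∑ p ∈ Finset.HasAntidiagonal.antidiagonal (k + 1), ‖P p.1‖ * ‖R p.2‖) * ρ ^ (k + 1) := by
      rw [Finset.sum_mul]
      refine Finset.sum_congr rfl fun p hp => ?_
      rw [← Finset.HasAntidiagonal.mem_antidiagonal.1 hp, pow_add]
      simp only [a, r]
      ring
    rw [h4]
    have h5 := mul_le_mul_of_nonneg_right h2 (pow_nonneg hρ (k + 1))
    simp only [a]
    refine le_trans (le_of_eq ?_) (h5.trans (le_of_eq ?_)) <;> ring
  obtain ⟨N, hN⟩ := exists_nat_gt S
  refine ⟨∑ m ∈ Finset.range (N + 1), a m, Finset.sum_nonneg fun m _ => ha0 m, ?_⟩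
  set M := ∑ m ∈ Finset.range (N + 1), a m with hM
  have hM0 : 0 ≤ M := Finset.sum_nonneg fun m _ => ha0 m
  intro k
  change a k ≤ M
  induction k using Nat.strong_induction_on with
  | _ k ih =>
    by_cases hk : k < N + 1
    · exact Finset.single_le_sum (fun m _ => ha0 m) (Finset.mem_range.2 hk)
    · obtain ⟨k, rfl⟩ : ∃ l, k = l + 1 := ⟨k - 1, by omega⟩
      by_contra! hlt
      -- A first term above `M` dominates all its predecessors, so the recursion gives `(k+1) a
      -- (k+1) ≤ S a (k+1)`, against `k + 1 ≥ N > S`.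
      have hle : ∀ m ≤ k + 1, a m ≤ a (k + 1) := fun m hm => by
        rcases hm.lt_or_eq with h | h
        · exact (ih m h).trans hlt.le
        · rw [h]
      have hsum : ∑ p ∈ Finset.HasAntidiagonal.antidiagonal (k + 1), a p.1 * r p.2
          ≤ a (k + 1) * ∑' k, r k := by
        calc _ ≤ ∑ p ∈ Finset.HasAntidiagonal.antidiagonal (k + 1), a (k + 1) * r p.2 :=
              Finset.sum_le_sum fun p hp => mul_le_mul_of_nonneg_right
                (hle _ (Finset.HasAntidiagonal.antidiagonal.fst_le hp)) (hr0 _)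
          _ = a (k + 1) * ∑ m ∈ Finset.range (k + 2), r m := by
              rw [← Finset.mul_sum, Finset.Nat.sum_antidiagonal_eq_sum_range_succ_mk]
              exact congrArg _ (Finset.sum_range_reflect r (k + 2))
          _ ≤ _ := mul_le_mul_of_nonneg_left
              ((hR ρ hρ).sum_le_tsum _ fun m _ => hr0 m) (ha0 _)
      have h1 := hrec k
      have h2 : ρ * ‖B‖ * a k ≤ ρ * ‖B‖ * a (k + 1) :=
        mul_le_mul_of_nonneg_left (hle k (Nat.le_succ k)) (by positivity)
      have h3 : (k + 1 : ℝ) * a (k + 1) ≤ S * a (k + 1) := by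
        rw [hS]
        linarith
      have h4 : (N : ℝ) ≤ k + 1 := by exact_mod_cast (by omega : N ≤ k + 1)
      have h5 : 0 < a (k + 1) := hM0.trans_lt hlt
      nlinarith

theorem summable_norm_mul_pow_of_forall_bounded {E : Type*} [NormedAddCommGroup E] {P : ℕ → E}
    (h : ∀ ρ : ℝ, 0 ≤ ρ → ∃ M, 0 ≤ M ∧ ∀ k, ‖P k‖ * ρ ^ k ≤ M) {ρ : ℝ} (hρ : 0 ≤ ρ) :
    Summable fun k => ‖P k‖ * ρ ^ k := by
  obtain ⟨M, -, hM⟩ := h (ρ + 1) (by positivity)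
  have hq : ρ / (ρ + 1) < 1 := (div_lt_one (by positivity)).2 (lt_add_one ρ)
  refine Summable.of_nonneg_of_le (fun k => by positivity) (fun k => ?_)
    ((summable_geometric_of_lt_one (by positivity) hq).mul_left M)
  have : ‖P k‖ * ρ ^ k = ‖P k‖ * (ρ + 1) ^ k * (ρ / (ρ + 1)) ^ k := by
    rw [div_pow]
    field_simp
  rw [this]
  exact mul_le_mul_of_nonneg_right (hM k) (by positivity)

theorem summable_pow_smul {E : Type*} [NormedAddCommGroup E] [NormedSpace ℂ E] {P : ℕ → E}
    (h : ∀ ρ : ℝ, 0 ≤ ρ → Summable fun k => ‖P k‖ * ρ ^ k) (z : ℂ) :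
    Summable fun k => ‖z ^ k • P k‖ :=
  (h ‖z‖ (norm_nonneg z)).congr fun k => by rw [norm_smul, norm_pow, mul_comm]

theorem hasDerivAt_tsum_pow_smul {E : Type*} [NormedAddCommGroup E] [NormedSpace ℂ E]
    [CompleteSpace E] {P : ℕ → E} (h : ∀ ρ : ℝ, 0 ≤ ρ → Summable fun k => ‖P k‖ * ρ ^ k) (z : ℂ) :
    HasDerivAt (fun w : ℂ => ∑' k, w ^ k • P k) (∑' k : ℕ, ((k : ℂ) * z ^ (k - 1)) • P k) z ∧
    Summable fun k : ℕ => ((k : ℂ) * z ^ (k - 1)) • P k := by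
  set ρ : ℝ := ‖z‖ + 1 with hρ
  have hρ1 : 1 ≤ ρ := by linarith [norm_nonneg z]
  -- The factor `k` is absorbed by `2^k`, and `ρ ≥ 1` allows the exponent `k - 1` to be raised to
  -- `k`.
  have hb : ∀ (k : ℕ), ∀ w ∈ Metric.ball (0 : ℂ) ρ, ‖((k : ℂ) * w ^ (k - 1)) • P k‖
      ≤ ‖P k‖ * (2 * ρ) ^ k := by
    intro k w hw
    have hw' : ‖w‖ ≤ ρ := (mem_ball_zero_iff.1 hw).le
    have h1 : (k : ℝ) ≤ 2 ^ k := by exact_mod_cast Nat.lt_two_pow_self.le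
    have h2 : ‖w‖ ^ (k - 1) ≤ ρ ^ k :=
      (pow_le_pow_left₀ (norm_nonneg _) hw' _).trans (pow_le_pow_right₀ hρ1 (Nat.sub_le _ _))
    rw [norm_smul, norm_mul, norm_pow, Complex.norm_natCast, mul_comm, mul_pow]
    gcongr
  have hs := h (2 * ρ) (by positivity)
  have hz : z ∈ Metric.ball (0 : ℂ) ρ := by simp [hρ]
  refine ⟨hasDerivAt_tsum_of_isPreconnected hs Metric.isOpen_ball
    (convex_ball (0 : ℂ) ρ).isPreconnected (fun k w _ => ?_) hb hz
    (summable_pow_smul h z).of_norm hz, Summable.of_norm_bounded hs fun k => hb k z hz⟩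
  simpa using (hasDerivAt_pow k w).smul_const (P k)

/-- Convergence of the formal gauge transformation. -/
theorem smul_deriv_tsum_of_formal_levelt [CompleteSpace 𝔸] (hP0 : P 0 = 1) (hR0 : R 0 = J)
    (hR : ∀ ρ : ℝ, 0 ≤ ρ → Summable fun k => ‖R k‖ * ρ ^ k)
    (hP : ∀ k, ((k + 1 : ℕ) : ℂ) • P (k + 1) + ∑ p ∈ Finset.HasAntidiagonal.antidiagonal (k + 1), P p.1 * R p.2
      = J * P (k + 1) + B * P k) (z : ℂ) :
    z • deriv (fun w : ℂ => ∑' k, w ^ k • P k) z + (∑' k, z ^ k • P k) * ∑' k, z ^ k • R k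
      = (J + z • B) * ∑' k, z ^ k • P k := by
  have hPs : ∀ ρ : ℝ, 0 ≤ ρ → Summable fun k => ‖P k‖ * ρ ^ k := fun ρ hρ =>
    summable_norm_mul_pow_of_forall_bounded
      (fun ρ hρ => exists_bound_of_formal_levelt hR hP hρ) hρ
  obtain ⟨hd, hds⟩ := hasDerivAt_tsum_pow_smul hPs z
  have hPz := (summable_pow_smul hPs z).of_norm
  have hcauchy := tsum_mul_tsum_eq_tsum_sum_antidiagonal_of_summable_norm
    (summable_pow_smul hPs z) (summable_pow_smul hR z)
  have hcs := (summable_norm_sum_mul_antidiagonal_of_summable_norm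
    (summable_pow_smul hPs z) (summable_pow_smul hR z)).of_norm
  rw [hd.deriv, hcauchy, ← hds.tsum_const_smul, ← (hds.const_smul z).tsum_add hcs,
    ((hds.const_smul z).add hcs).tsum_eq_zero_add, add_mul, hPz.tsum_eq_zero_add, mul_add,
    ← ((summable_nat_add_iff 1).2 hPz).tsum_mul_left]
  have hB : z • B * (z ^ 0 • P 0 + ∑' k, z ^ (k + 1) • P (k + 1))
      = ∑' k, z • B * (z ^ k • P k) := by
    rw [hPz.tsum_mul_left, hPz.tsum_eq_zero_add]
  rw [hB, add_assoc (J * _), ← (((summable_nat_add_iff 1).2 hPz).mul_left J).tsum_add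
    (hPz.mul_left (z • B))]
  congr 1
  · simp [hP0, hR0]
  · refine tsum_congr fun k => ?_
    have h1 : ∑ p ∈ Finset.HasAntidiagonal.antidiagonal (k + 1), z ^ p.1 • P p.1 * z ^ p.2 • R p.2
        = z ^ (k + 1) • ∑ p ∈ Finset.HasAntidiagonal.antidiagonal (k + 1), P p.1 * R p.2 := by
      rw [Finset.smul_sum]
      refine Finset.sum_congr rfl fun p hp => ?_
      rw [smul_mul_smul_comm, ← pow_add, Finset.HasAntidiagonal.mem_antidiagonal.1 hp]
    rw [h1, Nat.add_sub_cancel, smul_smul, mul_left_comm, ← pow_succ', mul_comm, mul_smul,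
      ← smul_add, hP k, smul_add, mul_smul_comm, smul_mul_smul_comm, pow_succ' z k]

end Convergence

/-! ### Entrywise calculus versus calculus in the normed ring of matrices -/

section MatrixCalculus

open scoped Matrix.Norms.Operator

variable {n : ℕ} {E : Type*} [NormedAddCommGroup E] [NormedSpace ℂ E]

/-- The entry `(a, b)` of a matrix, as a continuous linear map. -/
noncomputable def matrixEntry (a b : Fin n) : Matrix (Fin n) (Fin n) ℂ →L[ℂ] ℂ :=
  LinearMap.toContinuousLinearMap (Matrix.entryLinearMap ℂ ℂ a b)

theorem holomorphicMatrixOn_iff {f : E → Matrix (Fin n) (Fin n) ℂ} {s : Set E} :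
    HolomorphicMatrixOn f s ↔ DifferentiableOn ℂ f s := by
  constructor
  · intro h
    have hf : f = fun x => ∑ a, ∑ b, f x a b • Matrix.single a b (1 : ℂ) := by
      ext1 x
      conv_lhs => rw [Matrix.matrix_eq_sum_single (f x)]
      simp [Matrix.smul_single]
    rw [hf]
    exact DifferentiableOn.fun_sum fun a _ => DifferentiableOn.fun_sum fun b _ =>
      (h a b).smul_const _
  · intro h a b
    exact (matrixEntry a b).differentiable.comp_differentiableOn h

theorem HasDerivAt.matrixDeriv_eq {f : ℂ → Matrix (Fin n) (Fin n) ℂ}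
    {f' : Matrix (Fin n) (Fin n) ℂ} {t : ℂ} (h : HasDerivAt f f' t) : matrixDeriv f t = f' := by
  ext a b
  exact ((matrixEntry a b).hasFDerivAt.comp_hasDerivAt t h).deriv

theorem HasFDerivAt.partialDerivU_eq {f : (Fin n → ℂ) → Matrix (Fin n) (Fin n) ℂ}
    {f' : (Fin n → ℂ) →L[ℂ] Matrix (Fin n) (Fin n) ℂ} {u : Fin n → ℂ} (h : HasFDerivAt f f' u)
    (j : Fin n) : partialDerivU j f u = f' (Pi.single j 1) := by
  refine HasDerivAt.matrixDeriv_eq ?_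
  have h1 : HasFDerivAt f f' (Function.update u j (u j)) := by rwa [Function.update_eq_self]
  exact h1.comp_hasDerivAt (u j) (hasDerivAt_update u j (u j))

/-- A nonzero kernel vector, repeated in every column, would give a nonzero `C`. -/
theorem isUnit_of_forall_mul_eq_zero {M : Matrix (Fin n) (Fin n) ℂ}
    (h : ∀ C : Matrix (Fin n) (Fin n) ℂ, M * C = 0 → C = 0) : IsUnit M := by
  rw [Matrix.isUnit_iff_isUnit_det, isUnit_iff_ne_zero]
  intro hdet
  obtain ⟨v, hv, hMv⟩ := Matrix.exists_mulVec_eq_zero_iff.2 hdet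
  have hC := h (Matrix.of fun i _ => v i) (by
    ext i j
    exact congrFun hMv i)
  refine hv (funext fun i => ?_)
  exact congrFun (congrFun hC i) i

theorem DifferentiableAt.matrix_inv {f : E → Matrix (Fin n) (Fin n) ℂ} {x : E}
    (hf : DifferentiableAt ℂ f x) (hu : IsUnit (f x)) : DifferentiableAt ℂ (fun y => (f y)⁻¹) x := by
  simp only [Matrix.nonsing_inv_eq_ringInverse]
  exact (differentiableAt_inverse (𝕜 := ℂ) hu).comp x hf

end MatrixCalculus

/-! ### Levelt exponents of a sorted Jordan matrix -/

section LeveltExponents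

/-- The sorting key of an eigenvalue: its class modulo `ℤ` first, then its integral part, in
decreasing order. -/
noncomputable def leveltKey (μ : ℂ) : (ℝ ×ₗ ℝ) ×ₗ ℤ :=
  toLex (toLex (Int.fract μ.re, μ.im), -⌊μ.re⌋)

/-- The blocks are the classes of eigenvalues modulo `ℤ`, numbered by their rank among the pairs
(fractional part of the real part, imaginary part), and `σ` is that pair read as a complex number.
The sorting key makes classes consecutive and floors non-increasing inside each. -/
theorem exists_leveltExponents {n : ℕ} {μ : Fin n → ℂ} (hμ : Monotone fun i => leveltKey (μ i)) :
    ∃ (ℓ : ℕ) (b : Fin n → Fin ℓ) (σ : Fin ℓ → ℂ), Monotone b ∧ Function.Surjective b ∧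
      Function.Injective σ ∧ (∀ q, 0 ≤ (σ q).re ∧ (σ q).re < 1) ∧
      (∀ i, μ i = (⌊(μ i).re⌋ : ℂ) + σ (b i)) ∧
      (∀ i j, b i = b j → i ≤ j → ⌊(μ j).re⌋ ≤ ⌊(μ i).re⌋) := by
  let τ : Fin n → ℝ ×ₗ ℝ := fun i => toLex (Int.fract (μ i).re, (μ i).im)
  have hle : ∀ i j, i ≤ j → τ i < τ j ∨ τ i = τ j ∧ ⌊(μ j).re⌋ ≤ ⌊(μ i).re⌋ := by
    intro i j hij
    rcases Prod.Lex.toLex_le_toLex.1 (hμ hij) with h | h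
    · exact Or.inl h
    · exact Or.inr ⟨h.1, neg_le_neg_iff.1 h.2⟩
  let S : Finset (ℝ ×ₗ ℝ) := Finset.univ.image τ
  let o : Fin S.card ≃o S := S.orderIsoOfFin rfl
  have hτS : ∀ i, τ i ∈ S := fun i => Finset.mem_image_of_mem _ (Finset.mem_univ i)
  let b : Fin n → Fin S.card := fun i => o.symm ⟨τ i, hτS i⟩
  have hob : ∀ i, ((o (b i) : S) : ℝ ×ₗ ℝ) = τ i := fun i => by simp [b]
  let σ : Fin S.card → ℂ := fun q =>
    ⟨(ofLex ((o q : S) : ℝ ×ₗ ℝ)).1, (ofLex ((o q : S) : ℝ ×ₗ ℝ)).2⟩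
  have hsurj : Function.Surjective b := by
    intro q
    obtain ⟨i, -, hi⟩ := Finset.mem_image.1 (o q).2
    refine ⟨i, o.injective (Subtype.ext ?_)⟩
    rw [hob, hi]
  have hσb : ∀ i, σ (b i) = ⟨Int.fract (μ i).re, (μ i).im⟩ := fun i => by
    simp only [σ, hob]
    rfl
  refine ⟨S.card, b, σ, ?_, hsurj, ?_, ?_, ?_, ?_⟩
  · intro i j hij
    refine o.symm.monotone (Subtype.mk_le_mk.2 ?_)
    rcases hle i j hij with h | h
    · exact h.le
    · exact h.1.le
  · intro p q hpq
    refine o.injective (Subtype.ext ?_)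
    have h1 := congrArg Complex.re hpq
    have h2 := congrArg Complex.im hpq
    exact ofLex.injective (Prod.ext h1 h2)
  · intro q
    obtain ⟨i, rfl⟩ := hsurj q
    rw [hσb]
    exact ⟨Int.fract_nonneg _, Int.fract_lt_one _⟩
  · intro i
    rw [hσb]
    apply Complex.ext
    · simp
    · simp
  · intro i j hij hij'
    rcases hle i j hij' with h | h
    · exact absurd (by rw [← hob i, ← hob j, hij]) h.ne
    · exact h.2

theorem zpowDiag_mul_mul_zpowDiag_neg {n : ℕ} (d : Fin n → ℤ) (M : Matrix (Fin n) (Fin n) ℂ) {z : ℂ}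
    (hz : z ≠ 0) (i j : Fin n) :
    (zpowDiag d z * M * zpowDiag (-d) z) i j = z ^ (d i - d j) * M i j := by
  rw [zpowDiag, zpowDiag, Matrix.mul_diagonal, Matrix.diagonal_mul, Pi.neg_apply, sub_eq_add_neg,
    zpow_add₀ hz]
  ring

open scoped Matrix.Norms.Operator in
/-- Levelt's normal form for the system `z Y' = (J + z B) Y` with `J` a sorted Jordan matrix. -/
theorem exists_levelt_normalForm {n : ℕ} (J B : Matrix (Fin n) (Fin n) ℂ) (hJ : IsJordanMatrix J)
    (hmono : Monotone fun i => leveltKey (J i i)) :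
    ∃ (d : Fin n → ℤ) (L : Matrix (Fin n) (Fin n) ℂ) (P R : ℂ → Matrix (Fin n) (Fin n) ℂ),
      IsLeveltExponents d L ∧ (∀ i, (d i : ℂ) + L i i = J i i) ∧
      Differentiable ℂ P ∧ Differentiable ℂ R ∧ P 0 = 1 ∧ R 0 = J ∧
      (∀ z, z ≠ 0 → R z = leveltResidue d L z) ∧
      ∀ z, z • deriv P z + P z * R z = (J + z • B) * P z := by
  obtain ⟨P, R, hP0, hR0, hres, hrec⟩ := exists_formal_levelt J B hJ.bidiagonal
  obtain ⟨ℓ, b, σ, hb, hbs, hσ, hσ01, hμ, hd⟩ := exists_leveltExponents hmono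
  set d : Fin n → ℤ := fun i => ⌊(J i i).re⌋ with hd_def
  have hJd : ∀ i, J i i = (d i : ℂ) + σ (b i) := hμ
  -- If two eigenvalues differ by an integer, the corresponding `σ` differ by an integer of absolute
  -- value `< 1`, so they coincide; the shift is then carried by `d` alone.
  have hresonance : ∀ (k : ℕ) i j, J i i - J j j = k → b i = b j ∧ d i - d j = k := by
    intro k i j h
    rw [hJd, hJd] at h
    have h1 : σ (b i) - σ (b j) = ((k - d i + d j : ℤ) : ℂ) := by
      push_cast
      linear_combination h
    have h2 : (σ (b i)).re - (σ (b j)).re = ((k - d i + d j : ℤ) : ℝ) := by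
      have := congrArg Complex.re h1
      rwa [Complex.sub_re, Complex.intCast_re] at this
    have h3 := hσ01 (b i)
    have h4 := hσ01 (b j)
    have h5 : (k - d i + d j : ℤ) < 1 := by
      have : ((k - d i + d j : ℤ) : ℝ) < 1 := by linarith
      exact_mod_cast this
    have h6 : -1 < (k - d i + d j : ℤ) := by
      have : (-1 : ℝ) < ((k - d i + d j : ℤ) : ℝ) := by linarith
      exact_mod_cast this
    have h7 : (k - d i + d j : ℤ) = 0 := by omega
    rw [h7, Int.cast_zero, sub_eq_zero] at h1
    exact ⟨hσ h1, by omega⟩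
  have hRne : ∀ k i j, R k i j ≠ 0 → b i = b j ∧ d i - d j = k := by
    rintro (_ | k) i j h
    · refine hresonance 0 i j ?_
      rw [hR0] at h
      by_cases hij : j = i
      · simp [hij]
      · have hj : (j : ℕ) = i + 1 := by
          by_contra hne
          exact h (hJ.bidiagonal i j hij hne)
        rcases hJ.superdiagonal i j hj with h0 | h1
        · exact absurd h0 h
        · simp [h1.2]
    · exact hresonance (k + 1) i j (hres k i j h)
  -- The coefficient `R k` lives on entries with `d i - d j = k`, so only finitely many are nonzero
  -- and `∑ R k z^k` is a polynomial.
  obtain ⟨N, hN⟩ : ∃ N : ℕ, ∀ i j, d i - d j < N := by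
    obtain ⟨M, hM⟩ := (Set.finite_range fun p : Fin n × Fin n => d p.1 - d p.2).bddAbove
    refine ⟨(M + 1).toNat, fun i j => ?_⟩
    have : d i - d j ≤ M := hM ⟨(i, j), rfl⟩
    omega
  have hRN : ∀ k, k ∉ Finset.range N → R k = 0 := by
    intro k hk
    ext i j
    by_contra h
    have h1 := (hRne k i j h).2
    have h2 := hN i j
    rw [Finset.mem_range, not_lt] at hk
    omega
  have hRs : ∀ ρ : ℝ, 0 ≤ ρ → Summable fun k => ‖R k‖ * ρ ^ k := fun ρ _ =>
    summable_of_ne_finset_zero (s := Finset.range N) fun k hk => by rw [hRN k hk]; simp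
  have hPs : ∀ ρ : ℝ, 0 ≤ ρ → Summable fun k => ‖P k‖ * ρ ^ k := fun ρ hρ =>
    summable_norm_mul_pow_of_forall_bounded
      (fun ρ hρ => exists_bound_of_formal_levelt hRs hrec hρ) hρ
  -- `T` is the value of this polynomial at `z = 1`. Each entry contains the single power `z^(d i -
  -- d j)`, so the polynomial is `z^D T z^{-D}`, which equals `D + z^D L z^{-D}` for `L = T - D`.
  set T : Matrix (Fin n) (Fin n) ℂ := ∑ k ∈ Finset.range N, R k with hT
  set L : Matrix (Fin n) (Fin n) ℂ := T - Matrix.diagonal fun i => (d i : ℂ) with hL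
  have hTne : ∀ i j, T i j ≠ 0 → ∃ k, R k i j ≠ 0 := by
    intro i j h
    by_contra! hall
    refine h ?_
    rw [hT, Matrix.sum_apply]
    exact Finset.sum_eq_zero fun k _ => hall k
  have hTdiag : ∀ i, T i i = J i i := by
    intro i
    rw [hT, Matrix.sum_apply, Finset.sum_eq_single 0, hR0]
    · intro k _ hk
      by_contra h
      have := (hRne k i i h).2
      omega
    · intro h
      rw [hRN 0 h]
      rfl
  have hLdiag : ∀ i, L i i = J i i - d i := fun i => by simp [hL, hTdiag]
  have hLoff : ∀ i j, i ≠ j → L i j = T i j := fun i j h => by simp [hL, h]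
  have hRz : ∀ z : ℂ, ∑' k, z ^ k • R k = ∑ k ∈ Finset.range N, z ^ k • R k := fun z =>
    tsum_eq_sum fun k hk => by rw [hRN k hk, smul_zero]
  refine ⟨d, L, fun z => ∑' k, z ^ k • P k, fun z => ∑' k, z ^ k • R k, ?_, ?_, ?_, ?_, ?_, ?_,
    ?_, ?_⟩
  · refine ⟨ℓ, b, σ, hb, hbs, hσ, hσ01, ?_, ?_, ?_, hd⟩
    · intro i j hij
      rw [hLoff i j fun h => hij (by rw [h])]
      by_contra h
      obtain ⟨k, hk⟩ := hTne i j h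
      exact hij (hRne k i j hk).1
    · intro i j hji
      rw [hLoff i j hji.ne']
      by_contra h
      obtain ⟨k, hk⟩ := hTne i j h
      obtain ⟨h1, h2⟩ := hRne k i j hk
      -- Below the diagonal the shift `d i - d j` is nonpositive, so only `R 0 = J` could
      -- contribute, and `J` is upper triangular.
      have h3 : d i ≤ d j := hd j i h1.symm hji.le
      obtain rfl : k = 0 := by omega
      rw [hR0] at hk
      refine hk (hJ.bidiagonal i j hji.ne ?_)
      have : (j : ℕ) < i := hji
      omega
    · intro i
      rw [hLdiag, hJd]
      ring
  · intro i
    rw [hLdiag]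
    ring
  · exact fun z => (hasDerivAt_tsum_pow_smul hPs z).1.differentiableAt
  · exact fun z => (hasDerivAt_tsum_pow_smul hRs z).1.differentiableAt
  · dsimp only
    rw [tsum_eq_single 0 fun k hk => by simp [hk], pow_zero, one_smul, hP0]
  · dsimp only
    rw [tsum_eq_single 0 fun k hk => by simp [hk], pow_zero, one_smul, hR0]
  · intro z hz
    dsimp only
    rw [hRz]
    ext i j
    have hTz : (∑ k ∈ Finset.range N, z ^ k • R k) i j = z ^ (d i - d j) * T i j := by
      rw [hT, Matrix.sum_apply, Matrix.sum_apply, Finset.mul_sum]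
      refine Finset.sum_congr rfl fun k _ => ?_
      rw [Matrix.smul_apply, smul_eq_mul]
      by_cases h : R k i j = 0
      · rw [h, mul_zero, mul_zero]
      · rw [(hRne k i j h).2, zpow_natCast]
    rw [hTz, leveltResidue, Matrix.add_apply, zpowDiag_mul_mul_zpowDiag_neg d L hz]
    by_cases hij : i = j
    · subst hij
      rw [Matrix.diagonal_apply_eq, sub_self, zpow_zero, one_mul, one_mul, hTdiag, hLdiag]
      ring
    · rw [Matrix.diagonal_apply_ne _ hij, zero_add, hLoff i j hij]
  · exact fun z => smul_deriv_tsum_of_formal_levelt hP0 hR0 hRs hrec z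

end LeveltExponents

/-! ### The fundamental solution in Levelt form for fixed parameters -/

section BasePoint

open scoped Matrix.Norms.Operator

variable {n : ℕ}

theorem zpowDiag_neg_mul_self (d : Fin n → ℤ) {z : ℂ} (hz : z ≠ 0) :
    zpowDiag (-d) z * zpowDiag d z = 1 := by
  rw [zpowDiag, zpowDiag, Matrix.diagonal_mul_diagonal, ← Matrix.diagonal_one]
  congr 1
  ext i
  rw [Pi.neg_apply, ← zpow_add₀ hz]
  simp

theorem isUnit_zpowDiag (d : Fin n → ℤ) {z : ℂ} (hz : z ≠ 0) : IsUnit (zpowDiag d z) :=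
  IsUnit.of_mul_eq_one_right _ (zpowDiag_neg_mul_self d hz)

theorem leveltResidue_mul_zpowDiag (d : Fin n → ℤ) (L : Matrix (Fin n) (Fin n) ℂ) {z : ℂ}
    (hz : z ≠ 0) : leveltResidue d L z * zpowDiag d z
      = Matrix.diagonal (fun i => (d i : ℂ)) * zpowDiag d z + zpowDiag d z * L := by
  rw [leveltResidue, add_mul, mul_assoc (zpowDiag d z * L), zpowDiag_neg_mul_self d hz, mul_one]

theorem hasDerivAt_matrix_exp_smul (L : Matrix (Fin n) (Fin n) ℂ) (ζ : ℂ) :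
    HasDerivAt (fun ζ : ℂ => NormedSpace.exp (ζ • L)) (L * NormedSpace.exp (ζ • L)) ζ :=
  hasDerivAt_exp_smul_const' (𝕂 := ℂ) L ζ

theorem hasDerivAt_zpowDiag_exp (d : Fin n → ℤ) (ζ : ℂ) :
    HasDerivAt (fun ζ => zpowDiag d (Complex.exp ζ))
      (Matrix.diagonal (fun i => (d i : ℂ)) * zpowDiag d (Complex.exp ζ)) ζ := by
  have hform : (fun ζ => zpowDiag d (Complex.exp ζ))
      = fun ζ => NormedSpace.exp (ζ • Matrix.diagonal fun i => (d i : ℂ)) := by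
    ext1 ζ
    rw [← Matrix.diagonal_smul, Matrix.exp_diagonal, zpowDiag]
    congr 1
    ext i
    rw [Pi.coe_exp, ← Complex.exp_eq_exp_ℂ, ← Complex.exp_int_mul, mul_comm]
    rfl
  have := hasDerivAt_matrix_exp_smul (Matrix.diagonal fun i => (d i : ℂ)) ζ
  rw [← congrFun hform ζ] at this
  rwa [hform]

/-- The solution `P(z) z^D z^L` of `z Y' = (J + z B) Y`, in the coordinate `ζ = log z`. -/
theorem hasDerivAt_levelt_solution {J B L : Matrix (Fin n) (Fin n) ℂ} {d : Fin n → ℤ}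
    {P R : ℂ → Matrix (Fin n) (Fin n) ℂ} (hP : Differentiable ℂ P)
    (hR : ∀ z, z ≠ 0 → R z = leveltResidue d L z)
    (hPR : ∀ z, z • deriv P z + P z * R z = (J + z • B) * P z) (ζ : ℂ) :
    HasDerivAt (fun ζ => P (Complex.exp ζ) * zpowDiag d (Complex.exp ζ) * NormedSpace.exp (ζ • L))
      ((J + Complex.exp ζ • B)
        * (P (Complex.exp ζ) * zpowDiag d (Complex.exp ζ) * NormedSpace.exp (ζ • L))) ζ := by
  have h1 : HasDerivAt (fun ζ => P (Complex.exp ζ)) (Complex.exp ζ • deriv P (Complex.exp ζ)) ζ :=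
    (hP _).hasDerivAt.scomp ζ (Complex.hasDerivAt_exp ζ)
  have h2 := hasDerivAt_zpowDiag_exp d ζ
  have h3 := hasDerivAt_matrix_exp_smul L ζ
  refine ((h1.mul h2).mul h3).congr_deriv ?_
  have h4 := leveltResidue_mul_zpowDiag d L (Complex.exp_ne_zero ζ)
  rw [← hR _ (Complex.exp_ne_zero ζ)] at h4
  have h5 := hPR (Complex.exp ζ)
  generalize NormedSpace.exp (ζ • L) = e at *
  simp only [Pi.mul_apply]
  rw [mul_assoc (P _) _ e, ← mul_assoc _ (P _), ← h5, add_mul (Complex.exp ζ • _),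
    mul_assoc (P _) (R _),
    ← mul_assoc (R _), h4]
  simp only [add_mul, mul_add, mul_assoc, smul_mul_assoc, add_assoc]

/-- A solution which is invertible far to the left is invertible everywhere. -/
theorem isUnit_of_hasDerivAt_mul {a F : ℂ → Matrix (Fin n) (Fin n) ℂ} (ha : Continuous a)
    (hF : ∀ ζ, HasDerivAt F (a ζ * F ζ) ζ) (hleft : ∀ ζ, ∃ T : ℝ, IsUnit (F (ζ - T))) (ζ : ℂ) :
    IsUnit (F ζ) := by
  refine isUnit_of_forall_mul_eq_zero fun C hC => ?_
  obtain ⟨T, hT⟩ := hleft ζ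
  -- A horizontal segment from `ζ - T`, where `F` is invertible, to `ζ`, where `F * C` vanishes;
  -- uniqueness carries the zero back to `ζ - T`.
  let c : ℝ → ℂ := fun t => ζ + ((t : ℂ) - 1) * T
  have hc : ∀ t, HasDerivAt c T t := fun t => by
    have := (((Complex.ofRealCLM.hasDerivAt (x := t)).sub_const 1).mul_const (T : ℂ)).const_add ζ
    exact this.congr_deriv (by simp)
  have hcc : Continuous c := by fun_prop
  have h0 := eq_zero_of_hasDerivAt_mul_of_right (a := fun t => (T : ℂ) • a (c t))
    (f := fun t => F (c t) * C) (by fun_prop) (fun t _ => ?_) (by simpa [c] using hC)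
  · have hc0 : c 0 = ζ - T := by simp [c]; ring
    rw [hc0] at h0
    exact hT.mul_right_eq_zero.1 h0
  · refine (((hF (c t)).scomp t (hc t)).mul_const C).congr_deriv ?_
    rw [smul_mul_assoc, smul_mul_assoc, mul_assoc]

/-- As `Re ζ → -∞`, `exp ζ → 0` and `P` tends to `P 0 = 1`, so the solution is invertible far to the
left; the linear equation propagates this to every `ζ`. -/
theorem isUnit_levelt_factor {J B L : Matrix (Fin n) (Fin n) ℂ} {d : Fin n → ℤ}
    {P R : ℂ → Matrix (Fin n) (Fin n) ℂ} (hP : Differentiable ℂ P) (hP0 : P 0 = 1)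
    (hR : ∀ z, z ≠ 0 → R z = leveltResidue d L z)
    (hPR : ∀ z, z • deriv P z + P z * R z = (J + z • B) * P z) (z : ℂ) : IsUnit (P z) := by
  have hfac : ∀ ζ : ℂ, IsUnit (zpowDiag d (Complex.exp ζ) * NormedSpace.exp (ζ • L)) := fun ζ =>
    (isUnit_zpowDiag d (Complex.exp_ne_zero ζ)).mul (Matrix.isUnit_exp _)
  by_cases hz : z = 0
  · rw [hz, hP0]
    exact isUnit_one
  · have hunit := isUnit_of_hasDerivAt_mul (a := fun ζ => J + Complex.exp ζ • B) (by fun_prop)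
      (hasDerivAt_levelt_solution hP hR hPR) (fun ζ => ?_) (Complex.log z)
    · rw [mul_assoc, Complex.exp_log hz] at hunit
      have h2 := hfac (Complex.log z)
      rw [Complex.exp_log hz] at h2
      exact (IsUnit.mul_right_iff h2).1 hunit
    · have hlim : Filter.Tendsto (fun T : ℝ => P (Complex.exp (ζ - T))) Filter.atTop (𝓝 1) := by
        rw [← hP0]
        refine (hP.continuous.tendsto 0).comp ?_
        refine Complex.tendsto_exp_comap_re_atBot.comp (Filter.tendsto_comap_iff.2 ?_)
        have : (Complex.re ∘ fun T : ℝ => ζ - T) = fun T : ℝ => ζ.re - T := by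
          ext T; simp
        rw [this]
        exact Filter.tendsto_atBot_add_const_left _ _ Filter.tendsto_neg_atTop_atBot
      obtain ⟨T, hT⟩ := (hlim.eventually (Units.isOpen.mem_nhds isUnit_one)).exists
      exact ⟨T, by rw [mul_assoc]; exact IsUnit.mul hT (hfac _)⟩

end BasePoint

/-! ### Transport of the operator `z∂_z - Q` -/

section Intertwining

variable {V 𝔸 : Type*} [NormedAddCommGroup V] [NormedSpace ℂ V] [NormedRing 𝔸]
  [NormedAlgebra ℂ 𝔸] {Ω : ℂ × V → V →L[ℂ] 𝔸} {U : Set V}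

/-- If the connection is compatible with the operator `z ∂_z - Q`, then its parallel transport
intertwines the restriction of that operator to the base point with the operator itself. -/
theorem transport_intertwines [FiniteDimensional ℂ V] [CompleteSpace 𝔸] (hU : IsOpen U)
    (h0 : (0 : V) ∈ U) (hstar : ∀ v ∈ U, ∀ s ∈ Set.Icc (0 : ℝ) 1, (s : ℂ) • v ∈ U)
    (hΩ : DifferentiableOn ℂ Ω (Set.univ ×ˢ U))
    (hpar : ∀ x ∈ Set.univ ×ˢ U, ∀ w, fderiv ℂ (transport Ω) x (0, w) = Ω x w * transport Ω x)
    {Q : ℂ × V → 𝔸} (hQ : DifferentiableOn ℂ Q (Set.univ ×ˢ U))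
    (hcomp : ∀ x ∈ Set.univ ×ˢ U, ∀ w, x.1 • fderiv ℂ Ω x (1, 0) w + Ω x w * Q x
      = fderiv ℂ Q x (0, w) + Q x * Ω x w)
    {x : ℂ × V} (hx : x ∈ Set.univ ×ˢ U) :
    x.1 • fderiv ℂ (transport Ω) x (1, 0) + transport Ω x * Q (x.1, 0)
      = Q x * transport Ω x := by
  have hO : IsOpen (Set.univ ×ˢ U : Set (ℂ × V)) := isOpen_univ.prod hU
  have hH := differentiableOn_transport hU hstar hΩ
  obtain ⟨z, v⟩ := x
  have hmem : ∀ v ∈ U, (z, v) ∈ (Set.univ ×ˢ U : Set (ℂ × V)) := fun v hv => ⟨trivial, hv⟩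
  -- For fixed `z`, the defect of the claimed identity is itself parallel in `v`. It vanishes at `v
  -- = 0`, where the transport is `1` for every `z` and so has zero `z`-derivative.
  have key := eq_zero_of_parallel (ω := fun v => Ω (z, v))
    (S := fun v => z • fderiv ℂ (transport Ω) (z, v) (1, 0) + transport Ω (z, v) * Q (z, 0)
      - Q (z, v) * transport Ω (z, v)) hU hstar
    (hΩ.continuousOn.comp (by fun_prop) hmem) ?_ ?_ ?_ v hx.2
  · exact sub_eq_zero.1 key
  · have hι : DifferentiableOn ℂ (fun v : V => (z, v)) U := by fun_prop
    refine DifferentiableOn.sub (DifferentiableOn.add (DifferentiableOn.const_smul ?_ z) ?_) ?_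
    · exact ((hH.fderiv_of_isOpen hO).comp hι hmem).clm_apply (differentiableOn_const _)
    · exact (hH.comp hι hmem).mul (differentiableOn_const _)
    · exact (hQ.comp hι hmem).mul (hH.comp hι hmem)
  · intro v hv w
    have hnx := hO.mem_nhds (hmem v hv)
    have hι : HasFDerivAt (fun v : V => (z, v)) (ContinuousLinearMap.inr ℂ ℂ V) v :=
      hasFDerivAt_prodMk_right z v
    have hHx : HasFDerivAt (transport Ω) (fderiv ℂ (transport Ω) (z, v)) (z, v) :=
      (hH.differentiableAt hnx).hasFDerivAt
    have hQx : HasFDerivAt Q (fderiv ℂ Q (z, v)) (z, v) := (hQ.differentiableAt hnx).hasFDerivAt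
    have hΩx : HasFDerivAt Ω (fderiv ℂ Ω (z, v)) (z, v) := (hΩ.differentiableAt hnx).hasFDerivAt
    have hH2 : HasFDerivAt (fderiv ℂ (transport Ω)) (fderiv ℂ (fderiv ℂ (transport Ω)) (z, v))
        (z, v) := ((hH.fderiv_of_isOpen hO).differentiableAt hnx).hasFDerivAt
    have hsymm : fderiv ℂ (fderiv ℂ (transport Ω)) (z, v) (0, w) (1, 0)
        = fderiv ℂ (fderiv ℂ (transport Ω)) (z, v) (1, 0) (0, w) := by
      have h2 : ContDiffAt ℂ (2 : ℕ) (transport Ω) (z, v) :=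
        (hH.contDiffOn_of_isOpen hO 2).contDiffAt hnx
      exact h2.isSymmSndFDerivAt (by simp [minSmoothness_of_isRCLikeNormedField]) _ _
    -- Differentiating the parallel equation in `z` and exchanging the derivatives gives the
    -- `v`-derivative of the first term of the defect.
    have heq : (fun y => fderiv ℂ (transport Ω) y (0, w))
        =ᶠ[𝓝 (z, v)] fun y => Ω y w * transport Ω y :=
      Filter.eventually_of_mem hnx fun y hy => hpar y hy w
    have hE1 := hH2.clm_apply (hasFDerivAt_const ((0 : ℂ), w) (z, v))
    have hE2 := (hΩx.clm_apply (hasFDerivAt_const w (z, v))).mul' hHx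
    have hE := DFunLike.congr_fun ((hE1.congr_of_eventuallyEq heq.symm).unique hE2)
      ((1 : ℂ), (0 : V))
    have hd1 := ((hH2.comp v hι).clm_apply (hasFDerivAt_const ((1 : ℂ), (0 : V)) v)).const_smul z
    have hd2 := (hHx.comp v hι).mul_const' (Q (z, 0))
    have hd3 := (hQx.comp v hι).mul' (hHx.comp v hι)
    have hD := DFunLike.congr_fun ((hd1.add hd2).sub hd3).fderiv w
    refine hD.trans ?_
    have hc := congrArg (· * transport Ω (z, v)) (hcomp (z, v) (hmem v hv) w)
    have hp := hpar (z, v) (hmem v hv) w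
    simp at hE hc ⊢
    rw [hsymm, hE, hp]
    rw [← sub_eq_zero] at hc ⊢
    rw [← hc]
    simp only [smul_add, smul_mul_assoc, add_mul, mul_add, mul_sub, mul_assoc, mul_smul_comm]
    abel
  · have hnx := hO.mem_nhds (hmem 0 h0)
    have h1 : HasDerivAt (fun s : ℂ => transport Ω (s, 0))
        (fderiv ℂ (transport Ω) (z, 0) (1, 0)) z := by
      have hι : HasDerivAt (fun s : ℂ => (s, (0 : V))) (1, 0) z :=
        (hasDerivAt_id z).prodMk (hasDerivAt_const z (0 : V))
      exact HasFDerivAt.comp_hasDerivAt (f := fun s : ℂ => (s, (0 : V))) z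
        (hH.differentiableAt hnx).hasFDerivAt hι
    simp only [transport_zero] at h1 ⊢
    rw [h1.unique (hasDerivAt_const z 1), smul_zero, zero_add, one_mul, mul_one, sub_self]

end Intertwining

/-! ### Polydiscs and translation to the origin -/

section Polydisc

variable {n : ℕ} (u0 : Fin n → ℂ) (r : Fin n → ℝ)

theorem isOpen_polydisc : IsOpen (polydisc u0 r) := by
  simp only [polydisc, Set.ofPred_forall]
  exact isOpen_iInter_of_finite fun j => isOpen_lt (by fun_prop) continuous_const

theorem smul_mem_polydisc_zero : ∀ v ∈ polydisc 0 r, ∀ s ∈ Set.Icc (0 : ℝ) 1,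
    (s : ℂ) • v ∈ polydisc 0 r := by
  intro v hv s hs j
  have hj := hv j
  simp only [Pi.zero_apply, sub_zero] at hj
  rw [Pi.smul_apply, Pi.zero_apply, sub_zero, norm_smul, Complex.norm_real,
    Real.norm_of_nonneg hs.1]
  exact (mul_le_of_le_one_left (norm_nonneg _) hs.2).trans_lt hj

theorem zero_mem_polydisc_zero (hr : ∀ j, 0 < r j) : (0 : Fin n → ℂ) ∈ polydisc 0 r := fun j => by
  simpa using hr j

variable {u0 r}

theorem add_mem_polydisc_iff {v : Fin n → ℂ} : u0 + v ∈ polydisc u0 r ↔ v ∈ polydisc 0 r := by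
  simp [polydisc]

theorem sub_mem_polydisc_iff {u : Fin n → ℂ} : u - u0 ∈ polydisc 0 r ↔ u ∈ polydisc u0 r := by
  simp [polydisc]

end Polydisc

theorem fderiv_sum_proj_smulRight {E F : Type*} [NormedAddCommGroup E] [NormedSpace ℂ E]
    [NormedAddCommGroup F] [NormedSpace ℂ F] {n : ℕ} {g : Fin n → E → F} {x : E}
    (h : ∀ j, DifferentiableAt ℂ (g j) x) :
    DifferentiableAt ℂ (fun y => ∑ j,
      (ContinuousLinearMap.proj (R := ℂ) (φ := fun _ : Fin n => ℂ) j).smulRight (g j y)) x ∧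
    ∀ k w, fderiv ℂ (fun y => ∑ j,
      (ContinuousLinearMap.proj (R := ℂ) (φ := fun _ : Fin n => ℂ) j).smulRight (g j y)) x k w
      = ∑ j, w j • fderiv ℂ (g j) x k := by
  let S : Fin n → F →L[ℂ] (Fin n → ℂ) →L[ℂ] F := fun j =>
    ContinuousLinearMap.smulRightL ℂ (Fin n → ℂ) F
      (ContinuousLinearMap.proj (R := ℂ) (φ := fun _ : Fin n => ℂ) j)
  have h1 : ∀ j, HasFDerivAt (fun y =>
      (ContinuousLinearMap.proj (R := ℂ) (φ := fun _ : Fin n => ℂ) j).smulRight (g j y))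
      ((S j).comp (fderiv ℂ (g j) x)) x := fun j => (S j).hasFDerivAt.comp x (h j).hasFDerivAt
  have hd := HasFDerivAt.fun_sum (u := Finset.univ) fun j _ => h1 j
  refine ⟨hd.differentiableAt, fun k w => ?_⟩
  rw [hd.fderiv]
  simp [S]

/-! ### The connection form in `u` and the Euler operator in `z` -/

section Connection

open scoped Matrix.Norms.Operator

variable {n : ℕ} {u0 : Fin n → ℂ} {r : Fin n → ℝ} {A : (Fin n → ℂ) → Matrix (Fin n) (Fin n) ℂ}
  {ω : Fin n → ℂ → (Fin n → ℂ) → Matrix (Fin n) (Fin n) ℂ}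

theorem partialDerivU_eq_of_hasFDerivAt_sub {f : ℂ × (Fin n → ℂ) → Matrix (Fin n) (Fin n) ℂ}
    {f' : ℂ × (Fin n → ℂ) →L[ℂ] Matrix (Fin n) (Fin n) ℂ} {z : ℂ} {u : Fin n → ℂ}
    (h : HasFDerivAt f f' (z, u - u0)) (j : Fin n) :
    partialDerivU j (fun u => f (z, u - u0)) u = f' (0, Pi.single j 1) := by
  have h1 : HasFDerivAt (fun u : Fin n → ℂ => (z, u - u0)) (ContinuousLinearMap.inr ℂ ℂ _) u :=
    (hasFDerivAt_const z u).prodMk ((hasFDerivAt_id u).sub_const u0)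
  exact (h.comp u h1).partialDerivU_eq j

theorem matrixDeriv_eq_of_hasFDerivAt {f : ℂ × (Fin n → ℂ) → Matrix (Fin n) (Fin n) ℂ}
    {f' : ℂ × (Fin n → ℂ) →L[ℂ] Matrix (Fin n) (Fin n) ℂ} {z : ℂ} {v : Fin n → ℂ}
    (h : HasFDerivAt f f' (z, v)) : matrixDeriv (fun s => f (s, v)) z = f' (1, 0) :=
  HasDerivAt.matrixDeriv_eq
    (h.comp_hasDerivAt z ((hasDerivAt_id z).prodMk (hasDerivAt_const z v)))

/-- The coefficients `ω_j`, with the centre of the polydisc moved to the origin. -/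
def centredCoeff (u0 : Fin n → ℂ) (ω : Fin n → ℂ → (Fin n → ℂ) → Matrix (Fin n) (Fin n) ℂ)
    (j : Fin n) (x : ℂ × (Fin n → ℂ)) : Matrix (Fin n) (Fin n) ℂ :=
  ω j x.1 (u0 + x.2)

/-- The connection form `∑ ω_j du_j`, with the centre of the polydisc moved to the origin. -/
noncomputable def connectionForm (u0 : Fin n → ℂ)
    (ω : Fin n → ℂ → (Fin n → ℂ) → Matrix (Fin n) (Fin n) ℂ) (x : ℂ × (Fin n → ℂ)) :
    (Fin n → ℂ) →L[ℂ] Matrix (Fin n) (Fin n) ℂ :=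
  ∑ j, (ContinuousLinearMap.proj (R := ℂ) (φ := fun _ : Fin n => ℂ) j).smulRight
    (centredCoeff u0 ω j x)

/-- `z ω₀(z, u) = z Λ + A(u)`, with the centre of the polydisc moved to the origin. -/
noncomputable def eulerCoeff (u0 : Fin n → ℂ) (A : (Fin n → ℂ) → Matrix (Fin n) (Fin n) ℂ)
    (x : ℂ × (Fin n → ℂ)) : Matrix (Fin n) (Fin n) ℂ :=
  x.1 • Matrix.diagonal (u0 + x.2) + A (u0 + x.2)

theorem connectionForm_apply (x : ℂ × (Fin n → ℂ)) (w : Fin n → ℂ) :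
    connectionForm u0 ω x w = ∑ j, w j • centredCoeff u0 ω j x := by
  simp [connectionForm]

theorem connectionForm_single (x : ℂ × (Fin n → ℂ)) (j : Fin n) :
    connectionForm u0 ω x (Pi.single j 1) = centredCoeff u0 ω j x := by
  rw [connectionForm_apply, Finset.sum_eq_single j]
  · simp
  · intro i _ hij
    simp [hij]
  · simp

theorem omegaZero_eq_smul_eulerCoeff {z : ℂ} (hz : z ≠ 0) (u : Fin n → ℂ) :
    omegaZero A z u = z⁻¹ • eulerCoeff u0 A (z, u - u0) := by
  simp only [omegaZero, eulerCoeff, add_sub_cancel]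
  rw [smul_add, inv_smul_smul₀ hz]

theorem centredCoeff_sub (j : Fin n) (z : ℂ) (u : Fin n → ℂ) :
    centredCoeff u0 ω j (z, u - u0) = ω j z u := by
  simp only [centredCoeff, add_sub_cancel]

theorem differentiableOn_centredCoeff
    (hω : ∀ j, HolomorphicMatrixOn (fun p : ℂ × (Fin n → ℂ) => ω j p.1 p.2)
      (Set.univ ×ˢ polydisc u0 r)) (j : Fin n) :
    DifferentiableOn ℂ (centredCoeff u0 ω j) (Set.univ ×ˢ polydisc 0 r) := by
  have h1 : DifferentiableOn ℂ (fun x : ℂ × (Fin n → ℂ) => (x.1, u0 + x.2))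
      (Set.univ ×ˢ polydisc 0 r) := by fun_prop
  exact (holomorphicMatrixOn_iff.1 (hω j)).comp h1 fun x hx =>
    ⟨trivial, add_mem_polydisc_iff.2 hx.2⟩

theorem differentiableOn_eulerCoeff (hA : HolomorphicMatrixOn A (polydisc u0 r)) :
    DifferentiableOn ℂ (eulerCoeff u0 A) (Set.univ ×ˢ polydisc 0 r) := by
  have h1 : DifferentiableOn ℂ (fun x : ℂ × (Fin n → ℂ) => u0 + x.2)
      (Set.univ ×ˢ polydisc 0 r) := by fun_prop
  have h2 : Differentiable ℂ (fun x : ℂ × (Fin n → ℂ) => Matrix.diagonal (u0 + x.2)) :=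
    ((Matrix.diagonalLinearMap (Fin n) ℂ ℂ).toContinuousLinearMap.differentiable).comp
      (by fun_prop : Differentiable ℂ fun x : ℂ × (Fin n → ℂ) => u0 + x.2)
  refine DifferentiableOn.add (DifferentiableOn.smul differentiable_fst.differentiableOn h2.differentiableOn) ?_
  exact (holomorphicMatrixOn_iff.1 hA).comp h1 fun x hx => add_mem_polydisc_iff.2 hx.2

theorem fderiv_connectionForm {x : ℂ × (Fin n → ℂ)}
    (h : ∀ j, DifferentiableAt ℂ (centredCoeff u0 ω j) x) :
    DifferentiableAt ℂ (connectionForm u0 ω) x ∧ ∀ k w, fderiv ℂ (connectionForm u0 ω) x k w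
      = ∑ j, w j • fderiv ℂ (centredCoeff u0 ω j) x k :=
  fderiv_sum_proj_smulRight h

theorem apply_eq_sum_single (D : ℂ × (Fin n → ℂ) →L[ℂ] Matrix (Fin n) (Fin n) ℂ)
    (w : Fin n → ℂ) : D (0, w) = ∑ i, w i • D (0, Pi.single i 1) := by
  have hw : w = ∑ i, w i • (Pi.single i 1 : Fin n → ℂ) := by
    ext k
    simp [Finset.sum_apply, Pi.single_apply]
  have h : ∀ v, D (0, v) = D.comp (ContinuousLinearMap.inr ℂ ℂ (Fin n → ℂ)) v := fun v => rfl
  simp only [h]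
  conv_lhs => rw [hw]
  simp only [map_sum, map_smul]

/-- Integrability is given only for `z ≠ 0`, but no term has a pole, so continuity extends it to `z
= 0`, where `G` will be constructed. The general identity follows by bilinear expansion in the
coordinate directions. -/
theorem connectionForm_flat
    (hω : ∀ j, HolomorphicMatrixOn (fun p : ℂ × (Fin n → ℂ) => ω j p.1 p.2)
      (Set.univ ×ˢ polydisc u0 r)) (hint : IsCompletelyIntegrable (polydisc u0 r) A ω)
    {x : ℂ × (Fin n → ℂ)} (hx : x ∈ Set.univ ×ˢ polydisc 0 r) (w₁ w₂ : Fin n → ℂ) :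
    fderiv ℂ (connectionForm u0 ω) x (0, w₁) w₂ + connectionForm u0 ω x w₂ * connectionForm u0 ω x w₁
      = fderiv ℂ (connectionForm u0 ω) x (0, w₂) w₁
        + connectionForm u0 ω x w₁ * connectionForm u0 ω x w₂ := by
  have hO : IsOpen (Set.univ ×ˢ polydisc 0 r : Set (ℂ × (Fin n → ℂ))) :=
    isOpen_univ.prod (isOpen_polydisc 0 r)
  have hg := differentiableOn_centredCoeff hω
  obtain ⟨z, v⟩ := x
  have hmem : ∀ s : ℂ, (s, v) ∈ (Set.univ ×ˢ polydisc 0 r : Set (ℂ × (Fin n → ℂ))) :=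
    fun s => ⟨trivial, hx.2⟩
  have hcomm : ∀ i j, fderiv ℂ (centredCoeff u0 ω j) (z, v) (0, Pi.single i 1)
      + centredCoeff u0 ω j (z, v) * centredCoeff u0 ω i (z, v)
      = fderiv ℂ (centredCoeff u0 ω i) (z, v) (0, Pi.single j 1)
      + centredCoeff u0 ω i (z, v) * centredCoeff u0 ω j (z, v) := by
    intro i j
    by_cases hij : i = j
    · rw [hij]
    have hc : ∀ j, Continuous fun s : ℂ => centredCoeff u0 ω j (s, v) := fun j =>
      continuousOn_univ.1 ((hg j).continuousOn.comp (by fun_prop) fun s _ => hmem s)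
    have hc' : ∀ j w, Continuous fun s : ℂ => fderiv ℂ (centredCoeff u0 ω j) (s, v) w := fun j w =>
      (continuousOn_univ.1 (((hg j).fderiv_of_isOpen hO).continuousOn.comp (by fun_prop)
        fun s _ => hmem s)).clm_apply continuous_const
    refine congrFun (Continuous.ext_on (dense_compl_singleton (0 : ℂ))
      (f := fun s => fderiv ℂ (centredCoeff u0 ω j) (s, v) (0, Pi.single i 1)
        + centredCoeff u0 ω j (s, v) * centredCoeff u0 ω i (s, v))
      (g := fun s => fderiv ℂ (centredCoeff u0 ω i) (s, v) (0, Pi.single j 1)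
        + centredCoeff u0 ω i (s, v) * centredCoeff u0 ω j (s, v))
      ((hc' j _).add ((hc j).mul (hc i))) ((hc' i _).add ((hc i).mul (hc j))) ?_) z
    intro s hs
    have h1 := hint.comm_uu s hs (u0 + v) (add_mem_polydisc_iff.2 hx.2) i j hij
    have hp : ∀ i j, partialDerivU i (ω j s) (u0 + v)
        = fderiv ℂ (centredCoeff u0 ω j) (s, v) (0, Pi.single i 1) := by
      intro i j
      have h2 : HasFDerivAt (centredCoeff u0 ω j) (fderiv ℂ (centredCoeff u0 ω j) (s, v))
          (s, u0 + v - u0) := by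
        rw [add_sub_cancel_left]
        exact ((hg j).differentiableAt (hO.mem_nhds (hmem s))).hasFDerivAt
      have := partialDerivU_eq_of_hasFDerivAt_sub h2 i
      simpa only [centredCoeff_sub] using this
    rw [hp, hp] at h1
    exact h1
  have hder := (fderiv_connectionForm (x := (z, v)) (u0 := u0) (ω := ω) fun j =>
    (hg j).differentiableAt (hO.mem_nhds hx)).2
  have hexp : ∀ w₁ w₂ : Fin n → ℂ, fderiv ℂ (connectionForm u0 ω) (z, v) (0, w₁) w₂
      + connectionForm u0 ω (z, v) w₂ * connectionForm u0 ω (z, v) w₁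
      = ∑ j, ∑ i, (w₂ j * w₁ i) • (fderiv ℂ (centredCoeff u0 ω j) (z, v) (0, Pi.single i 1)
        + centredCoeff u0 ω j (z, v) * centredCoeff u0 ω i (z, v)) := by
    intro w₁ w₂
    rw [hder, connectionForm_apply, connectionForm_apply, Finset.sum_mul_sum,
      ← Finset.sum_add_distrib]
    refine Finset.sum_congr rfl fun j _ => ?_
    rw [apply_eq_sum_single _ w₁, Finset.smul_sum, ← Finset.sum_add_distrib]
    refine Finset.sum_congr rfl fun i _ => ?_
    rw [smul_smul, smul_mul_smul_comm, smul_add]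
  rw [hexp, hexp, Finset.sum_comm]
  refine Finset.sum_congr rfl fun i _ => Finset.sum_congr rfl fun j _ => ?_
  rw [hcomm, mul_comm]

/-- Multiplying the mixed integrability condition by `z` clears the pole of `ω₀`, and density of `z
≠ 0` then gives the relation also at `z = 0`. -/
theorem connectionForm_compatible (hA : HolomorphicMatrixOn A (polydisc u0 r))
    (hω : ∀ j, HolomorphicMatrixOn (fun p : ℂ × (Fin n → ℂ) => ω j p.1 p.2)
      (Set.univ ×ˢ polydisc u0 r)) (hint : IsCompletelyIntegrable (polydisc u0 r) A ω)
    {x : ℂ × (Fin n → ℂ)} (hx : x ∈ Set.univ ×ˢ polydisc 0 r) (w : Fin n → ℂ) :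
    x.1 • fderiv ℂ (connectionForm u0 ω) x (1, 0) w + connectionForm u0 ω x w * eulerCoeff u0 A x
      = fderiv ℂ (eulerCoeff u0 A) x (0, w) + eulerCoeff u0 A x * connectionForm u0 ω x w := by
  have hO : IsOpen (Set.univ ×ˢ polydisc 0 r : Set (ℂ × (Fin n → ℂ))) :=
    isOpen_univ.prod (isOpen_polydisc 0 r)
  have hg := differentiableOn_centredCoeff hω
  have hQ := differentiableOn_eulerCoeff hA
  obtain ⟨z, v⟩ := x
  have hmem : ∀ s : ℂ, (s, v) ∈ (Set.univ ×ˢ polydisc 0 r : Set (ℂ × (Fin n → ℂ))) :=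
    fun s => ⟨trivial, hx.2⟩
  have hcomm : ∀ j, z • fderiv ℂ (centredCoeff u0 ω j) (z, v) (1, 0)
      + centredCoeff u0 ω j (z, v) * eulerCoeff u0 A (z, v)
      = fderiv ℂ (eulerCoeff u0 A) (z, v) (0, Pi.single j 1)
      + eulerCoeff u0 A (z, v) * centredCoeff u0 ω j (z, v) := by
    intro j
    have hc : Continuous fun s : ℂ => centredCoeff u0 ω j (s, v) :=
      continuousOn_univ.1 ((hg j).continuousOn.comp (by fun_prop) fun s _ => hmem s)
    have hcQ : Continuous fun s : ℂ => eulerCoeff u0 A (s, v) :=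
      continuousOn_univ.1 (hQ.continuousOn.comp (by fun_prop) fun s _ => hmem s)
    have hc' : ∀ w, Continuous fun s : ℂ => fderiv ℂ (centredCoeff u0 ω j) (s, v) w := fun w =>
      (continuousOn_univ.1 (((hg j).fderiv_of_isOpen hO).continuousOn.comp (by fun_prop)
        fun s _ => hmem s)).clm_apply continuous_const
    have hcQ' : ∀ w, Continuous fun s : ℂ => fderiv ℂ (eulerCoeff u0 A) (s, v) w := fun w =>
      (continuousOn_univ.1 ((hQ.fderiv_of_isOpen hO).continuousOn.comp (by fun_prop)
        fun s _ => hmem s)).clm_apply continuous_const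
    refine congrFun (Continuous.ext_on (dense_compl_singleton (0 : ℂ))
      (f := fun s => s • fderiv ℂ (centredCoeff u0 ω j) (s, v) (1, 0)
        + centredCoeff u0 ω j (s, v) * eulerCoeff u0 A (s, v))
      (g := fun s => fderiv ℂ (eulerCoeff u0 A) (s, v) (0, Pi.single j 1)
        + eulerCoeff u0 A (s, v) * centredCoeff u0 ω j (s, v))
      ((continuous_id.smul (hc' _)).add (hc.mul hcQ)) ((hcQ' _).add (hcQ.mul hc)) ?_) z
    intro s hs
    have hs0 : s ≠ 0 := hs
    have h1 := hint.comm_zu s hs0 (u0 + v) (add_mem_polydisc_iff.2 hx.2) j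
    have hp1 : matrixDeriv (fun s => ω j s (u0 + v)) s
        = fderiv ℂ (centredCoeff u0 ω j) (s, v) (1, 0) :=
      matrixDeriv_eq_of_hasFDerivAt
        ((hg j).differentiableAt (hO.mem_nhds (hmem s))).hasFDerivAt
    have hp2 : partialDerivU j (omegaZero A s) (u0 + v)
        = s⁻¹ • fderiv ℂ (eulerCoeff u0 A) (s, v) (0, Pi.single j 1) := by
      have h2 : HasFDerivAt (fun x => s⁻¹ • eulerCoeff u0 A x)
          (s⁻¹ • fderiv ℂ (eulerCoeff u0 A) (s, v)) (s, u0 + v - u0) := by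
        rw [add_sub_cancel_left]
        exact (hQ.differentiableAt (hO.mem_nhds (hmem s))).hasFDerivAt.const_smul s⁻¹
      have h3 := partialDerivU_eq_of_hasFDerivAt_sub h2 j
      simp only [← omegaZero_eq_smul_eulerCoeff hs0] at h3
      exact h3
    rw [hp1, hp2, omegaZero_eq_smul_eulerCoeff (u0 := u0) hs0, add_sub_cancel_left] at h1
    have h4 := congrArg (fun M => s • M) h1
    simp only [smul_add, mul_smul_comm, smul_mul_assoc, smul_inv_smul₀ hs0] at h4
    exact h4
  have hder := (fderiv_connectionForm (x := (z, v)) (u0 := u0) (ω := ω) fun j =>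
    (hg j).differentiableAt (hO.mem_nhds hx)).2
  rw [hder, connectionForm_apply, apply_eq_sum_single _ w, Finset.smul_sum, Finset.sum_mul,
    Finset.mul_sum, ← Finset.sum_add_distrib, ← Finset.sum_add_distrib]
  refine Finset.sum_congr rfl fun j _ => ?_
  rw [smul_comm z, smul_mul_assoc, mul_smul_comm, ← smul_add, ← smul_add, hcomm]

end Connection

/-! ### Assembling the solution -/

section Main

open scoped Matrix.Norms.Operator

variable {n : ℕ}

/-- The partial derivatives in `z` of a holomorphic function are holomorphic. -/
theorem exists_differentiableOn_iteratedDeriv {V F : Type*} [NormedAddCommGroup V]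
    [NormedSpace ℂ V] [FiniteDimensional ℂ V] [NormedAddCommGroup F] [NormedSpace ℂ F]
    [CompleteSpace F] {U : Set V} (hU : IsOpen U) {f : ℂ × V → F}
    (hf : DifferentiableOn ℂ f (Set.univ ×ˢ U)) (k : ℕ) :
    ∃ g : ℂ × V → F, DifferentiableOn ℂ g (Set.univ ×ˢ U) ∧
      ∀ v ∈ U, (iteratedDeriv k fun s => f (s, v)) = fun z => g (z, v) := by
  have hO : IsOpen (Set.univ ×ˢ U : Set (ℂ × V)) := isOpen_univ.prod hU
  induction k with
  | zero => exact ⟨f, hf, fun v _ => iteratedDeriv_zero⟩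
  | succ k ih =>
    obtain ⟨g, hg, hgk⟩ := ih
    refine ⟨fun x => fderiv ℂ g x (1, 0),
      (hg.fderiv_of_isOpen hO).clm_apply (differentiableOn_const _), fun v hv => ?_⟩
    ext1 z
    rw [iteratedDeriv_succ, hgk v hv]
    have hι : HasDerivAt (fun s : ℂ => (s, v)) (1, 0) z :=
      (hasDerivAt_id z).prodMk (hasDerivAt_const z v)
    exact (HasFDerivAt.comp_hasDerivAt (f := fun s : ℂ => (s, v)) z
      (hg.differentiableAt (hO.mem_nhds ⟨trivial, hv⟩)).hasFDerivAt hι).deriv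

theorem charpoly_eq_prod_of_conj_isJordanMatrix {A G J : Matrix (Fin n) (Fin n) ℂ} (hG : IsUnit G)
    (hAG : A * G = G * J) (hJ : IsJordanMatrix J) :
    A.charpoly = ∏ i, (Polynomial.X - Polynomial.C (J i i)) := by
  have hdet : IsUnit G.det := (Matrix.isUnit_iff_isUnit_det G).1 hG
  have hA : A = G * J * G⁻¹ := by
    rw [← hAG, mul_assoc, Matrix.mul_nonsing_inv G hdet, mul_one]
  have h1 := Matrix.charpoly_units_conj hG.unit J
  rw [hG.unit_spec, ← hA] at h1
  rw [h1]
  refine Matrix.charpoly_of_isUpperTriangular J fun i j hij => ?_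
  have hlt : (j : ℕ) < i := hij
  exact hJ.bidiagonal i j (fun h => by rw [h] at hlt; omega) (by omega)

/-- All limits at `z = 0` are read off the entire function `R`, which extends `leveltResidue d L` by
the value `J`. The `Ψ j` are the Taylor coefficients of `Yhat` multiplied by `G⁻¹`. -/
theorem isLeveltForm_of_entire {A G J L : Matrix (Fin n) (Fin n) ℂ} {d : Fin n → ℤ}
    {R Yhat Y : ℂ → Matrix (Fin n) (Fin n) ℂ} (hG : IsUnit G) (hAG : A * G = G * J)
    (hJ : IsJordanMatrix J) (hexp : IsLeveltExponents d L) (hdiag : ∀ i, (d i : ℂ) + L i i = J i i)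
    (hR : Differentiable ℂ R) (hR0 : R 0 = J) (hRz : ∀ z, z ≠ 0 → R z = leveltResidue d L z)
    (hY : Differentiable ℂ Yhat) (hYu : ∀ z, IsUnit (Yhat z)) (hY0 : Yhat 0 = G)
    (hfac : ∀ ζ : ℂ, Y ζ
      = Yhat (Complex.exp ζ) * zpowDiag d (Complex.exp ζ) * NormedSpace.exp (ζ • L)) :
    IsLeveltForm A G (fun j => G⁻¹ * ((j.factorial : ℂ)⁻¹ • iteratedDeriv j Yhat 0)) d L J Yhat Y := by
  have hdet : IsUnit G.det := (Matrix.isUnit_iff_isUnit_det G).1 hG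
  have hGi : G * G⁻¹ = 1 := Matrix.mul_nonsing_inv G hdet
  have hiG : G⁻¹ * G = 1 := Matrix.nonsing_inv_mul G hdet
  have hA : G * J * G⁻¹ = A := by rw [← hAG, mul_assoc, hGi, mul_one]
  have hbd : Differentiable ℂ fun z => Yhat z * R z * (Yhat z)⁻¹ := fun z =>
    ((hY z).mul (hR z)).mul ((hY z).matrix_inv (hYu z))
  have hb0 : Yhat 0 * R 0 * (Yhat 0)⁻¹ = A := by rw [hY0, hR0, hA]
  have hne : ∀ᶠ z in 𝓝[≠] (0 : ℂ), R z = leveltResidue d L z :=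
    eventually_nhdsWithin_of_forall hRz
  refine ⟨hfac, fun z => ⟨G⁻¹ * Yhat z - 1, ?_, ?_⟩, hG, hJ, ?_, hexp, ?_, fun a b => ?_, ?_, ?_, ?_⟩
  · have h1 := (Complex.hasSum_taylorSeries_of_entire hY 0 z).mul_left G⁻¹
    have h2 : HasSum (fun j : ℕ => z ^ j • (G⁻¹ * ((j.factorial : ℂ)⁻¹ • iteratedDeriv j Yhat 0)))
        (G⁻¹ * Yhat z) := by
      refine h1.congr_fun ?_
      intro j
      rw [sub_zero, mul_smul_comm, mul_smul_comm, mul_smul_comm, smul_comm]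
    -- The term of index `0` is `G⁻¹ * Yhat 0 = 1`; removing it leaves the series over `j ≥ 1`.
    have h3 := (hasSum_nat_add_iff' 1).2 h2
    simpa [hY0, hiG] using h3
  · rw [add_sub_cancel, ← mul_assoc, hGi, one_mul]
  · rw [mul_assoc, hAG, ← mul_assoc, hiG, one_mul]
  · rw [charpoly_eq_prod_of_conj_isJordanMatrix hG hAG hJ]
    simp only [hdiag]
  · have hupd : Function.update (fun z => (Yhat z * leveltResidue d L z * (Yhat z)⁻¹) a b) 0 (A a b)
        = fun z => (Yhat z * R z * (Yhat z)⁻¹) a b := by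
      ext1 z
      by_cases hz : z = 0
      · rw [hz, Function.update_self, hb0]
      · rw [Function.update_of_ne hz, hRz z hz]
    rw [hupd]
    exact ((matrixEntry a b).differentiable.comp hbd).analyticAt 0
  · refine Filter.Tendsto.congr' (f₁ := fun z => Yhat z * R z * (Yhat z)⁻¹) ?_ ?_
    · filter_upwards [hne] with z hz
      rw [hz]
    · rw [← hb0]
      exact (hbd.continuous.tendsto 0).mono_left nhdsWithin_le_nhds
  · refine Filter.Tendsto.congr' (f₁ := fun z => G * R z * G⁻¹) ?_ ?_
    · filter_upwards [hne] with z hz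
      rw [hz]
    · rw [← hA, ← hR0]
      exact (((hR.continuous.const_mul G).mul_const G⁻¹).tendsto 0).mono_left nhdsWithin_le_nhds
  · refine Filter.Tendsto.congr' hne ?_
    rw [← hR0]
    exact (hR.continuous.tendsto 0).mono_left nhdsWithin_le_nhds

end Main

open scoped Matrix.Norms.Operator in
theorem mainTheorem5 (n : ℕ) (u0 : Fin n → ℂ) (r : Fin n → ℝ) (hr : ∀ j, 0 < r j)
    (A : (Fin n → ℂ) → Matrix (Fin n) (Fin n) ℂ)
    (ω : Fin n → ℂ → (Fin n → ℂ) → Matrix (Fin n) (Fin n) ℂ)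
    (hA : HolomorphicMatrixOn A (polydisc u0 r))
    (hω : ∀ j, HolomorphicMatrixOn (fun p : ℂ × (Fin n → ℂ) => ω j p.1 p.2)
      (Set.univ ×ˢ polydisc u0 r))
    (hint : IsCompletelyIntegrable (polydisc u0 r) A ω) :
    ∃ (d : Fin n → ℤ) (L J : Matrix (Fin n) (Fin n) ℂ)
      (G : (Fin n → ℂ) → Matrix (Fin n) (Fin n) ℂ)
      (Ψ : ℕ → (Fin n → ℂ) → Matrix (Fin n) (Fin n) ℂ)
      (Yhat Y : ℂ → (Fin n → ℂ) → Matrix (Fin n) (Fin n) ℂ),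
      IsFundamentalSolution (polydisc u0 r) A ω Y ∧
      (∀ u ∈ polydisc u0 r, IsLeveltForm (A u) (G u) (fun j => Ψ j u) d L J
        (fun z => Yhat z u) (fun ζ => Y ζ u)) ∧
      HolomorphicMatrixOn G (polydisc u0 r) ∧
      (∀ u ∈ polydisc u0 r, ∀ j, partialDerivU j G u = ω j 0 u * G u) ∧
      (∀ j, 1 ≤ j → HolomorphicMatrixOn (Ψ j) (polydisc u0 r)) ∧
      HolomorphicMatrixOn (fun p : ℂ × (Fin n → ℂ) => Yhat p.1 p.2)
        (Set.univ ×ˢ polydisc u0 r) := by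
  set U := polydisc (0 : Fin n → ℂ) r
  have hU : IsOpen U := isOpen_polydisc 0 r
  have hD : IsOpen (polydisc u0 r) := isOpen_polydisc u0 r
  have hstar := smul_mem_polydisc_zero r
  have h0 := zero_mem_polydisc_zero r hr
  have hO : IsOpen (Set.univ ×ˢ U : Set (ℂ × (Fin n → ℂ))) := isOpen_univ.prod hU
  set Ω := connectionForm u0 ω
  have hΩ : DifferentiableOn ℂ Ω (Set.univ ×ˢ U) := fun x hx =>
    (fderiv_connectionForm fun j => (differentiableOn_centredCoeff hω j).differentiableAt
      (hO.mem_nhds hx)).1.differentiableWithinAt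
  have hpar : ∀ x ∈ Set.univ ×ˢ U, ∀ w, fderiv ℂ (transport Ω) x (0, w) = Ω x w * transport Ω x :=
    fun x hx w => fderiv_transport hU hstar hΩ
      (fun y hy w₁ w₂ => connectionForm_flat hω hint hy w₁ w₂) hx w
  have hH := differentiableOn_transport hU hstar hΩ
  have hHu : ∀ x ∈ Set.univ ×ˢ U, IsUnit (transport Ω x) := fun x hx =>
    isUnit_of_forall_mul_eq_zero fun C hC => transport_mul_left_cancel hU hstar hΩ hpar hx hC
  have hHQ : ∀ x ∈ Set.univ ×ˢ U, x.1 • fderiv ℂ (transport Ω) x (1, 0)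
      + transport Ω x * eulerCoeff u0 A (x.1, 0) = eulerCoeff u0 A x * transport Ω x := fun x hx =>
    transport_intertwines hU h0 hstar hΩ hpar (differentiableOn_eulerCoeff hA)
      (fun y hy w => connectionForm_compatible hA hω hint hy w) hx
  obtain ⟨G₀, J, hG₀, hAG₀, hJ, hmono⟩ := exists_isJordanMatrix (A u0) leveltKey
  have hGi : G₀ * G₀⁻¹ = 1 :=
    Matrix.mul_nonsing_inv G₀ ((Matrix.isUnit_iff_isUnit_det G₀).1 hG₀)
  -- Conjugation by `G₀` turns the equation at the centre into `z Y' = (J + z B) Y` with this `B`.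
  -- The exponents are fixed here, once for all `u`.
  obtain ⟨d, L, P, R, hexp, hdiag, hP, hR, hP0, hR0, hRz, hPR⟩ :=
    exists_levelt_normalForm J (G₀⁻¹ * Matrix.diagonal u0 * G₀) hJ hmono
  have hPu := isUnit_levelt_factor hP hP0 hRz hPR
  set F : ℂ → Matrix (Fin n) (Fin n) ℂ := fun ζ =>
    G₀ * (P (Complex.exp ζ) * zpowDiag d (Complex.exp ζ) * NormedSpace.exp (ζ • L)) with hF
  have hFd : ∀ ζ, HasDerivAt F (eulerCoeff u0 A (Complex.exp ζ, 0) * F ζ) ζ := by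
    intro ζ
    refine ((hasDerivAt_levelt_solution hP hRz hPR ζ).const_mul G₀).congr_deriv ?_
    have h1 : G₀ * (J + Complex.exp ζ • (G₀⁻¹ * Matrix.diagonal u0 * G₀))
        = eulerCoeff u0 A (Complex.exp ζ, 0) * G₀ := by
      simp only [eulerCoeff, add_zero]
      rw [mul_add, add_mul, ← hAG₀, mul_smul_comm, smul_mul_assoc, mul_assoc G₀⁻¹,
        ← mul_assoc G₀ G₀⁻¹, hGi, one_mul, add_comm]
    rw [← mul_assoc G₀, h1, mul_assoc]
  have hFu : ∀ ζ, IsUnit (F ζ) := fun ζ => hG₀.mul (((hPu _).mul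
    (isUnit_zpowDiag d (Complex.exp_ne_zero ζ))).mul (Matrix.isUnit_exp _))
  have hmem : ∀ (z : ℂ) {u : Fin n → ℂ}, u ∈ polydisc u0 r →
      (z, u - u0) ∈ (Set.univ ×ˢ U : Set (ℂ × (Fin n → ℂ))) := fun z u hu =>
    ⟨trivial, sub_mem_polydisc_iff.2 hu⟩
  have hHx : ∀ (z : ℂ) {u : Fin n → ℂ}, u ∈ polydisc u0 r → HasFDerivAt (transport Ω)
      (fderiv ℂ (transport Ω) (z, u - u0)) (z, u - u0) := fun z u hu =>
    (hH.differentiableAt (hO.mem_nhds (hmem z hu))).hasFDerivAt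
  -- A right factor independent of `u` preserves parallelism. This is used with `C = F ζ` for `Y`,
  -- and with `z = 0`, `C = G₀` for `G`.
  have hHpart : ∀ (z : ℂ) (C : Matrix (Fin n) (Fin n) ℂ), ∀ u ∈ polydisc u0 r, ∀ j,
      partialDerivU j (fun u => transport Ω (z, u - u0) * C) u
        = ω j z u * (transport Ω (z, u - u0) * C) := by
    intro z C u hu j
    have h1 := partialDerivU_eq_of_hasFDerivAt_sub ((hHx z hu).mul_const' C) j
    refine h1.trans ?_
    have h2 := hpar _ (hmem z hu) (Pi.single j 1)
    rw [connectionForm_single, centredCoeff_sub] at h2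
    rw [← mul_assoc, ← h2]
    rfl
  have hHol : DifferentiableOn ℂ (fun p : ℂ × (Fin n → ℂ) => transport Ω (p.1, p.2 - u0))
      (Set.univ ×ˢ polydisc u0 r) :=
    hH.comp (by fun_prop) fun p hp => hmem p.1 hp.2
  have hYhat : DifferentiableOn ℂ
      (fun p : ℂ × (Fin n → ℂ) => transport Ω (p.1, p.2 - u0) * (G₀ * P p.1))
      (Set.univ ×ˢ polydisc u0 r) :=
    hHol.mul ((differentiableOn_const G₀).mul (hP.comp differentiable_fst).differentiableOn)
  have hslice : ∀ z : ℂ, DifferentiableOn ℂ (fun u : Fin n → ℂ => transport Ω (z, u - u0))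
      (polydisc u0 r) := fun z => hH.comp (by fun_prop) fun u hu => hmem z hu
  have hG : DifferentiableOn ℂ (fun u : Fin n → ℂ => transport Ω (0, u - u0) * G₀)
      (polydisc u0 r) := (hslice 0).mul (differentiableOn_const G₀)
  have hGu : ∀ u ∈ polydisc u0 r, IsUnit (transport Ω (0, u - u0) * G₀) := fun u hu =>
    (hHu _ (hmem 0 hu)).mul hG₀
  refine ⟨d, L, J, fun u => transport Ω (0, u - u0) * G₀,
    fun j u => (transport Ω (0, u - u0) * G₀)⁻¹ * ((j.factorial : ℂ)⁻¹ •
      iteratedDeriv j (fun z => transport Ω (z, u - u0) * (G₀ * P z)) 0),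
    fun z u => transport Ω (z, u - u0) * (G₀ * P z),
    fun ζ u => transport Ω (Complex.exp ζ, u - u0) * F ζ, ⟨?_, ?_, ?_, ?_⟩, ?_, ?_, ?_, ?_, ?_⟩
  · refine holomorphicMatrixOn_iff.2 (DifferentiableOn.mul ?_ ?_)
    · have h1 : DifferentiableOn ℂ (fun p : ℂ × (Fin n → ℂ) => (Complex.exp p.1, p.2))
          (Set.univ ×ˢ polydisc u0 r) := by fun_prop
      exact hHol.comp h1 fun p hp => ⟨trivial, hp.2⟩
    · have hFdiff : Differentiable ℂ F := fun ζ => (hFd ζ).differentiableAt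
      exact (hFdiff.comp differentiable_fst).differentiableOn
  · exact fun ζ u hu => (hHu _ (hmem _ hu)).mul (hFu ζ)
  · intro ζ u hu
    have hι : HasDerivAt (fun s : ℂ => (Complex.exp s, u - u0)) (Complex.exp ζ • (1, 0)) ζ :=
      ((Complex.hasDerivAt_exp ζ).prodMk (hasDerivAt_const ζ (u - u0))).congr_deriv (by simp)
    have h4 : fderiv ℂ (transport Ω) (Complex.exp ζ, u - u0) (Complex.exp ζ • (1, 0))
        = Complex.exp ζ • fderiv ℂ (transport Ω) (Complex.exp ζ, u - u0) (1, 0) := map_smul _ _ _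
    have h5 : HasDerivAt (fun s => transport Ω (Complex.exp s, u - u0))
        (Complex.exp ζ • fderiv ℂ (transport Ω) (Complex.exp ζ, u - u0) (1, 0)) ζ :=
      (HasFDerivAt.comp_hasDerivAt (f := fun s : ℂ => (Complex.exp s, u - u0)) ζ
        (hHx (Complex.exp ζ) hu) hι).congr_deriv h4
    have h1 := h5.mul (hFd ζ)
    have h2 := HasDerivAt.matrixDeriv_eq h1
    have h3 := hHQ _ (hmem (Complex.exp ζ) hu)
    dsimp only at h3
    rw [omegaZero_eq_smul_eulerCoeff (u0 := u0) (Complex.exp_ne_zero ζ), Complex.exp_neg,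
      smul_mul_assoc, ← mul_assoc, ← h3, add_mul, mul_assoc (transport Ω _)]
    exact congrArg _ h2
  · exact fun ζ u hu j => hHpart _ _ u hu j
  · intro u hu
    have hYd : Differentiable ℂ fun z => transport Ω (z, u - u0) * (G₀ * P z) := by
      refine differentiableOn_univ.1 ?_
      exact hYhat.comp (f := fun z : ℂ => (z, u)) (by fun_prop) fun z _ => ⟨trivial, hu⟩
    refine isLeveltForm_of_entire (hGu u hu) ?_ hJ hexp hdiag hR hR0 hRz hYd
      (fun z => (hHu _ (hmem z hu)).mul (hG₀.mul (hPu z))) (by rw [hP0, mul_one]) fun ζ => ?_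
    -- At `z = 0` the intertwining relation says that the transport conjugates `A u0` to `A u`, so
    -- `G u` brings every `A u` to the same `J`.
    · have h1 := hHQ _ (hmem 0 hu)
      simp only [eulerCoeff, zero_smul, zero_add, add_zero, add_sub_cancel] at h1
      rw [← mul_assoc, ← h1, mul_assoc, hAG₀, mul_assoc]
    · simp only [hF, mul_assoc]
  · exact holomorphicMatrixOn_iff.2 hG
  · exact fun u hu j => hHpart 0 G₀ u hu j
  · intro j _
    obtain ⟨g, hg, hgj⟩ := exists_differentiableOn_iteratedDeriv hD hYhat j
    have hg0 : DifferentiableOn ℂ (fun u => g (0, u)) (polydisc u0 r) :=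
      hg.comp (f := fun u => ((0 : ℂ), u)) (by fun_prop) fun u hu => ⟨trivial, hu⟩
    refine holomorphicMatrixOn_iff.2 (DifferentiableOn.mul (fun u hu => ?_) ?_)
    · exact ((hG.differentiableAt (hD.mem_nhds hu)).matrix_inv
        (hGu u hu)).differentiableWithinAt
    · have h1 : DifferentiableOn ℂ (fun u =>
          iteratedDeriv j (fun z => transport Ω (z, u - u0) * (G₀ * P z)) 0) (polydisc u0 r) :=
        hg0.congr fun u hu => congrFun (hgj u hu) 0
      exact h1.const_smul (j.factorial : ℂ)⁻¹
  · exact holomorphicMatrixOn_iff.2 hYhat
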